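/- Let $\mathbb H$ be the quaternions with inner product $b(x,y)=\mathrm{Re}(x\bar y)$, oriented by the basis $(1,i,j,k)$, and let $\mathrm{Vol}$ be its volume form. Let $\mathbb S^3\subset\mathbb H$ be the unit sphere and $U\mathbb S^3=\{(x,y)\in\mathbb H\times\mathbb H : b(x,x)=b(y,y)=1,\ b(x,y)=0\}$ its unit tangent bundle. At $(x,y)\in U\mathbb S^3$ let $W_{(x,y)}=\{(\xi,\mu) : \xi,\mu\perp x,y\}$, and on $W_{(x,y)}$ let $$\omega_i((\xi,\mu),(\xi',\mu'))=b(\xi,\mu')-b(\mu,\xi'),\qquad \omega_k((\xi,\mu),(\xi',\mu'))=\mathrm{Vol}(x,\xi,\xi',y)+\mathrm{Vol}(x,\mu,\mu',y),$$ $$\hat g((\xi,\mu),(\xi',\mu'))=b(\xi,\xi')+b(\mu,\mu'),\qquad J(\xi,\mu)=(-A\mu,A\xi),\quad Az=y\bar x z .$$ A smooth immersion $\phi=(X,Y):\mathbb R^2\to U\mathbb S^3$ is *bilegendrian* if its tangent planes lie in $W$ and $\phi^*\omega_i=\phi^*\omega_k=0$. Let $\hat{\mathcal B}$ be the space of bilegendrian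 immersions $\phi:\mathbb R^2\to U\mathbb S^3$, in normalized (complete) parametrization, that is, such that $\phi^*\hat g=2(dx_1^2+dx_2^2)$, $J\partial_1\phi=\partial_1\phi$ and $J\partial_2\phi=-\partial_2\phi$. Let $\mathcal B$ be its quotient by postcomposition with elements of $SO(\mathbb H)$, acting diagonally on $\mathbb H\times\mathbb H$. Spaces of smooth maps carry the $C^\infty_{\mathrm{loc}}$ topology, and $\mathcal B$ the quotient topology. For $\phi\in\hat{\mathcal B}$, an *angle function* is a smooth $\theta:\mathbb R^2\to\mathbb R$ such that $$\tfrac12(\partial_1+\partial_2)\phi=(\cos\theta\, e_1,\sin\theta\, e_1),\qquad \tfrac12(\partial_1-\partial_2)\phi=(-\sin\theta\, e_2,\cos\theta\, e_2)$$ for some smooth $e_1,e_2:\mathbb R^2\to\mathbb H$ such that $(X,e_1,e_2,Y)$ is everywhere orthonormal and positively oriented. The *initial angle* of $\phi$ is the number $\theta_0\in[0,2\pi[$ such that, after postcomposition of $\phi$ with some element of $SO(\mathbb H)$, $\phi(x_1,x_2)=(\gamma_2(x_2)\gamma_1(x_1),\gamma_2(x_2)\,k\,\gamma_1(x_1))$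 for smooth curves $\gamma_1,\gamma_2:\mathbb R\to\mathbb S^3$ with $\gamma_1(0)=\gamma_2(0)=1$, $\dot\gamma_1(0)=i$ and $\dot\gamma_2(0)=e^{\theta_0k}i$. **Theorem (classification of complete immersions).** For every $\phi\in\hat{\mathcal B}$ the initial angle $\theta_0$ exists and is unique, angle functions $\theta$ exist, $\partial_1\theta$ and $\partial_2\theta$ do not depend on the choice of $\theta$, and they are functions of $x_1$ alone and of $x_2$ alone respectively, so that $$\Theta(\phi):=(e^{i\theta_0},\partial_1\theta,\partial_2\theta)\in\mathbb S^1\times C^\infty(\mathbb R)\times C^\infty(\mathbb R)$$ is well defined. The map $\Theta$ descends to a homeomorphism from $\mathcal B$ onto $\mathbb S^1\times C^\infty(\mathbb R)\times C^\infty(\mathbb R)$. Furthermore, $\phi=(X,Y)\in\hat{\mathcal B}$ projects to a flat immersed surface in $\mathbb S^3$ (that is, $X:\mathbb R^2\to\mathbb S^3$ is an immersion whose induced metric is flat) if and only if $$\big(\theta_0/2+\mathrm I(\partial_1\theta)+\mathrm I(\partial_2\theta)\big)\cap(\pi/2)\mathbb Z=\emptyset,$$ where $\mathrm I(f)$ is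 the image of the function $F(x)=\int_0^x f(y)\,dy$, and the sum is the sum of sets. -/

import Mathlib

open Real Set Topology
open scoped Quaternion ContDiff Pointwise

noncomputable section

namespace Bilegendrian

/-! ### Spaces of smooth maps with the `C^∞_loc` topology -/

/-- Smooth maps between real normed spaces. -/
structure SmoothMap (E F : Type*) [NormedAddCommGroup E] [NormedSpace ℝ E]
    [NormedAddCommGroup F] [NormedSpace ℝ F] where
  toFun : E → F
  smooth : ContDiff ℝ ∞ toFun

instance {E F : Type*} [NormedAddCommGroup E] [NormedSpace ℝ E]
    [NormedAddCommGroup F] [NormedSpace ℝ F] : CoeFun (SmoothMap E F) (fun _ => E → F) :=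
  ⟨SmoothMap.toFun⟩

/-- The `n`-th derivative of a smooth map, as a continuous map. -/
def SmoothMap.derivative {E F : Type*} [NormedAddCommGroup E] [NormedSpace ℝ E]
    [NormedAddCommGroup F] [NormedSpace ℝ F] (n : ℕ) (f : SmoothMap E F) :
    C(E, E [×n]→L[ℝ] F) :=
  ⟨iteratedFDeriv ℝ n f.toFun,
    f.smooth.continuous_iteratedFDeriv (by exact_mod_cast le_top)⟩

/-- The `C^∞_loc` topology: uniform convergence on compact sets of all derivatives, that is, the
coarsest topology for which every derivative depends continuously on the map, spaces of continuous
maps having the compact-open topology. -/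
instance {E F : Type*} [NormedAddCommGroup E] [NormedSpace ℝ E]
    [NormedAddCommGroup F] [NormedSpace ℝ F] : TopologicalSpace (SmoothMap E F) :=
  ⨅ n : ℕ, TopologicalSpace.induced (SmoothMap.derivative n) inferInstance

/-! ### Quaternions, the unit tangent bundle of the 3-sphere and its Clifford structure -/

def qi : ℍ := ⟨0, 1, 0, 0⟩

def qj : ℍ := ⟨0, 0, 1, 0⟩

def qk : ℍ := ⟨0, 0, 0, 1⟩

/-- The volume form of `ℍ = ℝ⁴`, with `(1, i, j, k)` positively oriented. -/
def vol (a b c d : ℍ) : ℝ :=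
  Matrix.det !![a.re, a.imI, a.imJ, a.imK;
                b.re, b.imI, b.imJ, b.imK;
                c.re, c.imI, c.imJ, c.imK;
                d.re, d.imI, d.imJ, d.imK]

/-- The 3-sphere of unit quaternions. -/
def S3 : Set ℍ := {x | ‖x‖ = 1}

/-- The unit tangent bundle of the 3-sphere, as a subset of `ℍ × ℍ`. -/
def US3 : Set (ℍ × ℍ) :=
  {z | inner ℝ z.1 z.1 = 1 ∧ inner ℝ z.2 z.2 = 1 ∧ inner ℝ z.1 z.2 = 0}

/-- The contact plane `W` at `z = (x, y)`: pairs of vectors orthogonal to both `x` and `y`. -/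
def W (z : ℍ × ℍ) : Set (ℍ × ℍ) :=
  {v | inner ℝ v.1 z.1 = 0 ∧ inner ℝ v.1 z.2 = 0 ∧ inner ℝ v.2 z.1 = 0 ∧ inner ℝ v.2 z.2 = 0}

/-- The symplectic form `ω_i` on `W`. -/
def omegaI (v w : ℍ × ℍ) : ℝ := inner ℝ v.1 w.2 - inner ℝ v.2 w.1

/-- The symplectic form `ω_k` on `W` at `z = (x, y)` (for `η = -1`). -/
def omegaK (z v w : ℍ × ℍ) : ℝ := vol z.1 v.1 w.1 z.2 + vol z.1 v.2 w.2 z.2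

/-- The complementary inner product `ĝ` (for `η = -1`). -/
def gHat (v w : ℍ × ℍ) : ℝ := inner ℝ v.1 w.1 + inner ℝ v.2 w.2

/-- The rotation `A` by a right angle of the plane orthogonal to `x` and `y`, at `z = (x, y)`. -/
def rotA (z : ℍ × ℍ) (u : ℍ) : ℍ := z.2 * star z.1 * u

/-- The endomorphism `J` of `W` at `z` (for `η = -1`); it satisfies `J ^ 2 = 1`. -/
def endoJ (z v : ℍ × ℍ) : ℍ × ℍ := (-rotA z v.2, rotA z v.1)

/-! ### Bilegendrian immersions of the plane -/

/-- The coordinate vector field `∂₁` of the plane. -/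
def d1 : ℝ × ℝ := (1, 0)

/-- The coordinate vector field `∂₂` of the plane. -/
def d2 : ℝ × ℝ := (0, 1)

/-- Bilegendrian immersions of the plane in the unit tangent bundle of the 3-sphere. -/
structure IsBilegendrianImmersion (φ : ℝ × ℝ → ℍ × ℍ) : Prop where
  smooth : ContDiff ℝ ∞ φ
  mem_US3 : ∀ p, φ p ∈ US3
  immersion : ∀ p, Function.Injective (fderiv ℝ φ p)
  integral : ∀ p v, fderiv ℝ φ p v ∈ W (φ p)
  legendrianI : ∀ p v w, omegaI (fderiv ℝ φ p v) (fderiv ℝ φ p w) = 0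
  legendrianK : ∀ p v w, omegaK (φ p) (fderiv ℝ φ p v) (fderiv ℝ φ p w) = 0

/-- Normalized parametrizations: `φ^* ĝ = 2 (dx₁² + dx₂²)`, and the coordinate vectors
are eigenvectors of `J` with eigenvalues `1` and `-1`. -/
structure IsNormalized (φ : ℝ × ℝ → ℍ × ℍ) : Prop where
  metric : ∀ p v w : ℝ × ℝ,
    gHat (fderiv ℝ φ p v) (fderiv ℝ φ p w) = 2 * (v.1 * w.1 + v.2 * w.2)
  eigen₁ : ∀ p, endoJ (φ p) (fderiv ℝ φ p d1) = fderiv ℝ φ p d1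
  eigen₂ : ∀ p, endoJ (φ p) (fderiv ℝ φ p d2) = -fderiv ℝ φ p d2

/-- The space `B̂` of normalized bilegendrian immersions, with the `C^∞_loc` topology. -/
abbrev BHat : Type :=
  {φ : SmoothMap (ℝ × ℝ) (ℍ × ℍ) // IsBilegendrianImmersion φ ∧ IsNormalized φ}

/-- The group `SO(ℍ)` of orientation preserving linear isometries of `ℍ`. -/
def SOH : Subgroup (ℍ ≃ₗᵢ[ℝ] ℍ) where
  carrier := {R | LinearMap.det (R.toLinearEquiv : ℍ →ₗ[ℝ] ℍ) = 1}
  one_mem' := LinearMap.det_id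
  mul_mem' := by
    intro R S hR hS
    have h : ((R * S).toLinearEquiv : ℍ →ₗ[ℝ] ℍ)
        = (R.toLinearEquiv : ℍ →ₗ[ℝ] ℍ) ∘ₗ (S.toLinearEquiv : ℍ →ₗ[ℝ] ℍ) := rfl
    rw [Set.mem_ofPred_eq] at hR hS ⊢
    rw [h, LinearMap.det_comp, hR, hS, one_mul]
  inv_mem' := by
    intro R hR
    have h : (R.toLinearEquiv : ℍ →ₗ[ℝ] ℍ) ∘ₗ ((R⁻¹).toLinearEquiv : ℍ →ₗ[ℝ] ℍ)
        = LinearMap.id := by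
      ext1 x
      exact R.apply_symm_apply x
    have h' := congrArg LinearMap.det h
    rw [Set.mem_ofPred_eq] at hR ⊢
    rw [LinearMap.det_comp, LinearMap.det_id, hR, one_mul] at h'
    exact h'

/-- Postcomposition of a map to `ℍ × ℍ` with the diagonal action of an isometry of `ℍ`. -/
def postcomp (R : ℍ ≃ₗᵢ[ℝ] ℍ) (φ : ℝ × ℝ → ℍ × ℍ) (p : ℝ × ℝ) : ℍ × ℍ :=
  (R (φ p).1, R (φ p).2)

/-- Two elements of `B̂` are equivalent when they differ by postcomposition by an element
of `SO(ℍ)`. -/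
def orbitSetoid : Setoid BHat where
  r φ ψ := ∃ R ∈ SOH, (ψ.1 : ℝ × ℝ → ℍ × ℍ) = postcomp R φ.1
  iseqv :=
    { refl := fun φ => ⟨1, SOH.one_mem, rfl⟩
      symm := by
        rintro φ ψ ⟨R, hR, h⟩
        refine ⟨R⁻¹, SOH.inv_mem hR, ?_⟩
        rw [h]
        funext p
        exact Prod.ext (R.symm_apply_apply _).symm (R.symm_apply_apply _).symm
      trans := by
        rintro φ ψ χ ⟨R, hR, h⟩ ⟨S, hS, h'⟩
        refine ⟨S * R, SOH.mul_mem hS hR, ?_⟩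
        rw [h', h]
        rfl }

/-- The quotient `B` of `B̂` by `SO(ℍ)`, with the quotient topology. -/
abbrev BQuot : Type := Quotient orbitSetoid

/-! ### The map `Θ` -/

/-- The factorization `φ(x₁, x₂) = (γ₂(x₂) a γ₁(x₁), γ₂(x₂) b γ₁(x₁))`. -/
structure IsFactorization (φ : ℝ × ℝ → ℍ × ℍ) (a b : ℍ) (γ₁ γ₂ : ℝ → ℍ) : Prop where
  smooth₁ : ContDiff ℝ ∞ γ₁
  smooth₂ : ContDiff ℝ ∞ γ₂
  mem₁ : ∀ t, γ₁ t ∈ S3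
  mem₂ : ∀ t, γ₂ t ∈ S3
  zero₁ : γ₁ 0 = 1
  zero₂ : γ₂ 0 = 1
  eq : ∀ p, φ p = (γ₂ p.2 * a * γ₁ p.1, γ₂ p.2 * b * γ₁ p.1)

/-- `θ₀` is the initial angle of `φ`: up to postcomposition with an element of `SO(ℍ)`, the
factorization of `φ` has `a = 1`, `b = k`, `γ₁'(0) = i` and `γ₂'(0) = e^{θ₀ k} i`. -/
def IsInitialAngle (φ : ℝ × ℝ → ℍ × ℍ) (θ₀ : ℝ) : Prop :=
  θ₀ ∈ Ico 0 (2 * π) ∧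
    ∃ R ∈ SOH, ∃ γ₁ γ₂ : ℝ → ℍ, IsFactorization (postcomp R φ) 1 qk γ₁ γ₂ ∧
      deriv γ₁ 0 = qi ∧ deriv γ₂ 0 = NormedSpace.exp (θ₀ • qk) * qi

/-- `θ` is an angle function of `φ = (X, Y)`: with `∂̂₁ = (∂₁ + ∂₂) / 2` and
`∂̂₂ = (∂₁ - ∂₂) / 2`, one has `∂̂₁ φ = (cos θ e₁, sin θ e₁)` and
`∂̂₂ φ = (-sin θ e₂, cos θ e₂)` for unit sections `e₁`, `e₂` of the principal lines such that
`(X, e₁, e₂, Y)` is orthonormal and positively oriented. -/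
def IsAngleFunction (φ : ℝ × ℝ → ℍ × ℍ) (θ : ℝ × ℝ → ℝ) : Prop :=
  ContDiff ℝ ∞ θ ∧
    ∃ e₁ e₂ : ℝ × ℝ → ℍ, ContDiff ℝ ∞ e₁ ∧ ContDiff ℝ ∞ e₂ ∧ ∀ p,
      Orthonormal ℝ ![(φ p).1, e₁ p, e₂ p, (φ p).2] ∧
      0 < vol (φ p).1 (e₁ p) (e₂ p) (φ p).2 ∧
      fderiv ℝ φ p ((1 / 2 : ℝ) • (d1 + d2)) = (cos (θ p) • e₁ p, sin (θ p) • e₁ p) ∧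
      fderiv ℝ φ p ((1 / 2 : ℝ) • (d1 - d2)) = (-sin (θ p) • e₂ p, cos (θ p) • e₂ p)

/-- The space in which `Θ` takes its values. -/
abbrev Target : Type := Circle × SmoothMap ℝ ℝ × SmoothMap ℝ ℝ

/-- The relation `Θ(φ) = (e^{iθ₀}, ∂₁θ, ∂₂θ)`, where `θ₀` is the initial angle and `θ` the angle
function of `φ` (which exists and is unique up to a constant), and where `∂₁θ` and `∂₂θ` are
functions of, respectively, `x₁` and `x₂` alone. -/
def IsTheta (φ : ℝ × ℝ → ℍ × ℍ) (t : Target) : Prop :=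
  (∃ θ₀, IsInitialAngle φ θ₀ ∧ t.1 = Circle.exp θ₀) ∧
    (∃ θ, IsAngleFunction φ θ) ∧
    ∀ θ, IsAngleFunction φ θ → ∀ p : ℝ × ℝ,
      fderiv ℝ θ p d1 = t.2.1 p.1 ∧ fderiv ℝ θ p d2 = t.2.2 p.2

/-! ### Projection to flat surfaces -/

/-- The metric induced on the plane by `X` is flat: it is locally isometric to the euclidean
plane. (When `X` is an immersion, the charts `f` below are local diffeomorphisms, by the inverse
function theorem.) -/
def InducedMetricIsFlat (X : ℝ × ℝ → ℍ) : Prop :=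
  ∀ p, ∃ U : Set (ℝ × ℝ), IsOpen U ∧ p ∈ U ∧ ∃ f : ℝ × ℝ → EuclideanSpace ℝ (Fin 2),
    ContDiffOn ℝ ∞ f U ∧ ∀ q ∈ U, ∀ v w,
      inner ℝ (fderiv ℝ f q v) (fderiv ℝ f q w) = inner ℝ (fderiv ℝ X q v) (fderiv ℝ X q w)

/-- Flat immersed planes in the 3-sphere. -/
structure IsFlatImmersion (X : ℝ × ℝ → ℍ) : Prop where
  smooth : ContDiff ℝ ∞ X
  mem_S3 : ∀ p, X p ∈ S3
  immersion : ∀ p, Function.Injective (fderiv ℝ X p)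
  flat : InducedMetricIsFlat X

/-- The image of the primitive of `f` that vanishes at the origin. -/
def primitiveImage (f : SmoothMap ℝ ℝ) : Set ℝ := range fun x : ℝ => ∫ y in (0 : ℝ)..x, f y

end Bilegendrian

end

open Bilegendrian

noncomputable section

namespace Bilegendrian

/-! Put A = YX̄. The eigenvector equations for J say that ∂₁Y = A ∂₁X and ∂₂Y = -A ∂₂X. Since
tangent vectors are orthogonal to X and Y, the product YX̄ does not depend on x₁ and X̄Y does not
depend on x₂. Computing the mixed derivative of Y in both orders then gives ∂₁∂₂X = ∂₂X X̄ ∂₁X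
(`hasDerivAt_fderiv_d1`), so X̄ ∂₁X does not depend on x₂ (`maurerCartan_eq`) and φ is a product of
two curves (`fst_eq`, `snd_eq`). A rotation brings it to the form (γ₂γ₁, γ₂kγ₁) with γ₁' = ζ₁γ₁ and
γ₂' = γ₂ζ₂, where ζ₁(x₁) and ζ₂(x₂) are unit vectors of the plane of i and j, read as complex
numbers, and ζ₁(0) = 1 (`exists_isFrame`). Conversely, every such pair of curves gives a normalized
bilegendrian immersion.

The function ζ₂ζ̄₁ (`angleInvariant`) is invariant under rotations, equals e^{2iθ} for every angle
function θ, and equals e^{iθ₀} at the origin. Its argument is the sum of a function of x₁ and a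
function of x₂. Its value at the origin and half its logarithmic derivatives are therefore Θ;
integrating the angles, then the linear equations for γ₁ and γ₂, gives the inverse (`ofTarget`).

Both maps are continuous because convergence in C^∞_loc amounts to joint continuity of all
derivatives in parameter and point (`continuous_smoothMap_iff`), a property stable under
differentiation, bilinear operations, composition with smooth maps, primitives, and solving γ' = uγ
(`SmoothFam.quatExp`).

Finally, the metric induced by X is the pullback of the Euclidean one by ∫ζ₁ + ∫ζ₂, hence flat; X is
an immersion exactly where ζ₁ and ζ₂ are independent over ℝ, that is, where sin 2θ ≠ 0 with θ = θ₀/2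
+ F₁ + F₂. -/

/-! ### Parametrized families of smooth maps -/

section Families

variable {T : Type*} [TopologicalSpace T]
variable {E E' F G H : Type} [NormedAddCommGroup E] [NormedSpace ℝ E]
  [NormedAddCommGroup E'] [NormedSpace ℝ E']
  [NormedAddCommGroup F] [NormedSpace ℝ F] [NormedAddCommGroup G] [NormedSpace ℝ G]
  [NormedAddCommGroup H] [NormedSpace ℝ H]

/-- A family of `C^n` maps whose derivatives up to order `n` are continuous jointly in the
parameter and the point. -/
def FamContDiff (n : ℕ) (f : T → E → F) : Prop :=
  (∀ t, ContDiff ℝ n (f t)) ∧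
    ∀ m ≤ n, Continuous fun p : T × E => iteratedFDeriv ℝ m (f p.1) p.2

theorem famContDiff_zero {f : T → E → F} :
    FamContDiff 0 f ↔ Continuous fun p : T × E => f p.1 p.2 := by
  have key : (Continuous fun p : T × E => iteratedFDeriv ℝ 0 (f p.1) p.2) ↔
      Continuous fun p : T × E => f p.1 p.2 := by
    simp only [iteratedFDeriv_zero_eq_comp, Function.comp_def]
    exact (continuousMultilinearCurryFin0 ℝ E F).symm.toHomeomorph.comp_continuous_iff
  constructor
  · intro h
    exact key.1 (h.2 0 le_rfl)
  · intro h
    refine ⟨fun t => ?_, fun m hm => ?_⟩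
    · have := h.comp (Continuous.prodMk_right t)
      simp only [CharP.cast_eq_zero, contDiff_zero]
      exact this
    · obtain rfl : m = 0 := by omega
      exact key.2 h

/-- Peeling off the innermost derivative reduces each closure property to an induction on the order.
The target space must be generalized in these inductions, since the first derivative takes values in
another space. -/
theorem famContDiff_succ {n : ℕ} {f : T → E → F} :
    FamContDiff (n + 1) f ↔ (∀ t, Differentiable ℝ (f t)) ∧
      (Continuous fun p : T × E => f p.1 p.2) ∧ FamContDiff n (fun t => fderiv ℝ (f t)) := by
  have key : ∀ m : ℕ, (Continuous fun p : T × E => iteratedFDeriv ℝ (m + 1) (f p.1) p.2) ↔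
      Continuous fun p : T × E => iteratedFDeriv ℝ m (fderiv ℝ (f p.1)) p.2 := by
    intro m
    simp only [iteratedFDeriv_succ_eq_comp_right, Function.comp_def]
    exact (continuousMultilinearCurryRightEquiv' ℝ m E F).symm.toHomeomorph.comp_continuous_iff
  have hc : ∀ t, ContDiff ℝ (n + 1 : ℕ) (f t) ↔
      Differentiable ℝ (f t) ∧ ContDiff ℝ n (fderiv ℝ (f t)) := by
    intro t
    push_cast
    rw [contDiff_succ_iff_fderiv]
    simp
  constructor
  · intro h
    refine ⟨fun t => ((hc t).1 (h.1 t)).1, ?_, fun t => ((hc t).1 (h.1 t)).2, fun m hm => ?_⟩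
    · refine famContDiff_zero.1 ⟨fun t => (h.1 t).of_le (by simp), fun m hm => h.2 m (by omega)⟩
    · exact (key m).1 (h.2 (m + 1) (by omega))
  · rintro ⟨h1, h2, h3⟩
    refine ⟨fun t => (hc t).2 ⟨h1 t, h3.1 t⟩, fun m hm => ?_⟩
    cases m with
    | zero => exact (famContDiff_zero.2 h2).2 0 le_rfl
    | succ m => exact (key m).2 (h3.2 m (by omega))

theorem FamContDiff.continuous {n : ℕ} {f : T → E → F} (h : FamContDiff n f) :
    Continuous fun p : T × E => f p.1 p.2 :=
  famContDiff_zero.1 ⟨fun t => (h.1 t).of_le (by simp), fun m hm => h.2 m (by omega)⟩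

theorem FamContDiff.of_succ {n : ℕ} {f : T → E → F} (h : FamContDiff (n + 1) f) :
    FamContDiff n f :=
  ⟨fun t => (h.1 t).of_le (by simp), fun m hm => h.2 m (by omega)⟩

theorem FamContDiff.differentiable {n : ℕ} {f : T → E → F} (h : FamContDiff (n + 1) f) (t : T) :
    Differentiable ℝ (f t) :=
  (famContDiff_succ.1 h).1 t

theorem FamContDiff.fderiv {n : ℕ} {f : T → E → F} (h : FamContDiff (n + 1) f) :
    FamContDiff n (fun t => fderiv ℝ (f t)) :=
  (famContDiff_succ.1 h).2.2

theorem FamContDiff.clm_comp {n : ℕ} (L : F →L[ℝ] G) {f : T → E → F} (h : FamContDiff n f) :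
    FamContDiff n (fun t x => L (f t x)) := by
  induction n generalizing F G with
  | zero => exact famContDiff_zero.2 (L.continuous.comp h.continuous)
  | succ n ih =>
    refine famContDiff_succ.2 ⟨fun t => L.differentiable.comp (h.differentiable t),
      L.continuous.comp h.continuous, ?_⟩
    have := ih (ContinuousLinearMap.compL ℝ E F G L) h.fderiv
    convert this using 3 with t x
    exact (L.hasFDerivAt.comp x (h.differentiable t x).hasFDerivAt).fderiv

theorem FamContDiff.add {n : ℕ} {f g : T → E → F} (hf : FamContDiff n f) (hg : FamContDiff n g) :
    FamContDiff n (fun t x => f t x + g t x) := by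
  induction n generalizing F with
  | zero => exact famContDiff_zero.2 (hf.continuous.add hg.continuous)
  | succ n ih =>
    refine famContDiff_succ.2 ⟨fun t => (hf.differentiable t).add (hg.differentiable t),
      hf.continuous.add hg.continuous, ?_⟩
    have := ih hf.fderiv hg.fderiv
    convert this using 3 with t x
    exact fderiv_fun_add (hf.differentiable t x) (hg.differentiable t x)

theorem FamContDiff.bilinear {n : ℕ} (B : F →L[ℝ] G →L[ℝ] H) {f : T → E → F} {g : T → E → G}
    (hf : FamContDiff n f) (hg : FamContDiff n g) :
    FamContDiff n (fun t x => B (f t x) (g t x)) := by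
  induction n generalizing F G H with
  | zero =>
    exact famContDiff_zero.2 ((B.continuous.comp hf.continuous).clm_apply hg.continuous)
  | succ n ih =>
    refine famContDiff_succ.2 ⟨fun t x => ?_,
      (B.continuous.comp hf.continuous).clm_apply hg.continuous, ?_⟩
    · exact (B.hasFDerivAt_of_bilinear (hf.differentiable t x).hasFDerivAt
        (hg.differentiable t x).hasFDerivAt).differentiableAt
    have := (ih (B.precompR E) hf.of_succ hg.fderiv).add (ih (B.precompL E) hf.fderiv hg.of_succ)
    convert this using 3 with t x
    exact (B.hasFDerivAt_of_bilinear (hf.differentiable t x).hasFDerivAt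
        (hg.differentiable t x).hasFDerivAt).fderiv

/-- A family is smooth when all derivatives are continuous jointly in the parameter and the
point. -/
def SmoothFam (f : T → E → F) : Prop := ∀ n, FamContDiff n f

theorem SmoothFam.contDiff {f : T → E → F} (h : SmoothFam f) (t : T) : ContDiff ℝ ∞ (f t) :=
  contDiff_infty.2 fun n => (h n).1 t

theorem SmoothFam.continuous {f : T → E → F} (h : SmoothFam f) :
    Continuous fun p : T × E => f p.1 p.2 := (h 0).continuous

theorem SmoothFam.fderiv {f : T → E → F} (h : SmoothFam f) :
    SmoothFam (fun t => fderiv ℝ (f t)) := fun n => (h (n + 1)).fderiv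

theorem SmoothFam.clm_comp (L : F →L[ℝ] G) {f : T → E → F} (h : SmoothFam f) :
    SmoothFam (fun t x => L (f t x)) := fun n => (h n).clm_comp L

theorem SmoothFam.add {f g : T → E → F} (hf : SmoothFam f) (hg : SmoothFam g) :
    SmoothFam (fun t x => f t x + g t x) := fun n => (hf n).add (hg n)

theorem SmoothFam.bilinear (B : F →L[ℝ] G →L[ℝ] H) {f : T → E → F} {g : T → E → G}
    (hf : SmoothFam f) (hg : SmoothFam g) :
    SmoothFam (fun t x => B (f t x) (g t x)) := fun n => (hf n).bilinear B (hg n)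

theorem SmoothFam.mul {A : Type} [NormedRing A] [NormedAlgebra ℝ A] {f g : T → E → A}
    (hf : SmoothFam f) (hg : SmoothFam g) : SmoothFam (fun t x => f t x * g t x) :=
  SmoothFam.bilinear (ContinuousLinearMap.mul ℝ A) hf hg

theorem smoothFam_const_right {f : T → F} (hf : Continuous f) :
    SmoothFam (fun (t : T) (_ : E) => f t) := by
  have key : ∀ (n : ℕ) {F : Type} [NormedAddCommGroup F] [NormedSpace ℝ F] (f : T → F),
      Continuous f → FamContDiff n (fun (t : T) (_ : E) => f t) := by
    intro n
    induction n with
    | zero => exact fun f hf => famContDiff_zero.2 (hf.comp continuous_fst)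
    | succ n ih =>
      intro F _ _ f hf
      refine famContDiff_succ.2 ⟨fun t => differentiable_const _, hf.comp continuous_fst, ?_⟩
      convert ih (fun _ : T => (0 : E →L[ℝ] F)) continuous_const using 3 with t x
      simp
  exact fun n => key n f hf

theorem smoothFam_const_left {f : E → F} (hf : ContDiff ℝ ∞ f) :
    SmoothFam (fun (_ : T) (x : E) => f x) := fun n =>
  ⟨fun _ => hf.of_le (by exact_mod_cast le_top), fun m _ =>
    (hf.continuous_iteratedFDeriv (by exact_mod_cast le_top)).comp continuous_snd⟩

/-- By the chain rule the derivative is a bilinear expression in Dg ∘ f and Df. The induction is on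
`g`, with `f` fixed, so that it covers Dg ∘ f. -/
theorem SmoothFam.comp_left {g : F → G} (hg : ContDiff ℝ ∞ g) {f : T → E → F}
    (hf : SmoothFam f) : SmoothFam (fun t x => g (f t x)) := by
  have key : ∀ (n : ℕ) {G : Type} [NormedAddCommGroup G] [NormedSpace ℝ G] (g : F → G),
      ContDiff ℝ ∞ g → FamContDiff n (fun t x => g (f t x)) := by
    intro n
    induction n with
    | zero => exact fun g hg => famContDiff_zero.2 (hg.continuous.comp hf.continuous)
    | succ n ih =>
      intro G _ _ g hg
      have hd : Differentiable ℝ g := hg.differentiable (by simp)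
      have hfd := (hf 1).differentiable
      refine famContDiff_succ.2 ⟨fun t => hd.comp (hfd t),
        hg.continuous.comp hf.continuous, ?_⟩
      have := (ih (_root_.fderiv ℝ g) (contDiff_infty_iff_fderiv.1 hg).2).bilinear
        (ContinuousLinearMap.compL ℝ E F G) (hf.fderiv n)
      convert this using 3 with t x
      exact fderiv_comp x (hd _) (hfd t x)
  exact fun n => key n g hg

theorem SmoothFam.comp_right {h : E' → E} (hh : ContDiff ℝ ∞ h) {f : T → E → F}
    (hf : SmoothFam f) : SmoothFam (fun t x => f t (h x)) := by
  have key : ∀ (n : ℕ) {F : Type} [NormedAddCommGroup F] [NormedSpace ℝ F] (f : T → E → F),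
      SmoothFam f → FamContDiff n (fun t x => f t (h x)) := by
    intro n
    induction n with
    | zero =>
      exact fun f hf => famContDiff_zero.2 (hf.continuous.comp
        (continuous_fst.prodMk (hh.continuous.comp continuous_snd)))
    | succ n ih =>
      intro F _ _ f hf
      have hd : Differentiable ℝ h := hh.differentiable (by simp)
      have hfd := (hf 1).differentiable
      refine famContDiff_succ.2 ⟨fun t => (hfd t).comp hd, hf.continuous.comp
        (continuous_fst.prodMk (hh.continuous.comp continuous_snd)), ?_⟩
      have := (ih _ hf.fderiv).bilinear (ContinuousLinearMap.compL ℝ E' E F)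
        (smoothFam_const_left (contDiff_infty_iff_fderiv.1 hh).2 n)
      convert this using 3 with t x
      exact fderiv_comp x (hfd t _) (hd x)
  exact fun n => key n f hf

/-- Integration of families of one variable. -/
theorem FamContDiff.of_hasDerivAt {n : ℕ} {f g : T → ℝ → F}
    (hf : Continuous fun p : T × ℝ => f p.1 p.2) (hg : FamContDiff n g)
    (hfg : ∀ t x, HasDerivAt (f t) (g t x) x) : FamContDiff (n + 1) f := by
  refine famContDiff_succ.2 ⟨fun t x => (hfg t x).differentiableAt, hf, ?_⟩
  have := hg.clm_comp (ContinuousLinearMap.smulRightL ℝ ℝ F 1)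
  convert this using 3 with t x
  exact (hfg t x).hasFDerivAt.fderiv

theorem SmoothFam.of_hasDerivAt {f g : T → ℝ → F}
    (hf : Continuous fun p : T × ℝ => f p.1 p.2) (hg : SmoothFam g)
    (hfg : ∀ t x, HasDerivAt (f t) (g t x) x) : SmoothFam f :=
  fun n => ((hg n).of_hasDerivAt hf hfg).of_succ

theorem SmoothFam.comp_param {S : Type*} [TopologicalSpace S] {σ : S → T} (hσ : Continuous σ)
    {f : T → E → F} (hf : SmoothFam f) : SmoothFam (fun s => f (σ s)) := fun n =>
  ⟨fun s => (hf n).1 (σ s), fun m hm => ((hf n).2 m hm).comp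
    ((hσ.comp continuous_fst).prodMk continuous_snd)⟩

/-- Continuity for the `C^∞_loc` topology is joint continuity of all derivatives. -/
theorem continuous_smoothMap_iff [LocallyCompactSpace E] {f : T → SmoothMap E F} :
    Continuous f ↔ SmoothFam (fun t => (f t : E → F)) := by
  have : Continuous f ↔ ∀ m : ℕ,
      Continuous fun p : T × E => iteratedFDeriv ℝ m (f p.1 : E → F) p.2 := by
    rw [continuous_iInf_rng]
    refine forall_congr' fun m => ?_
    rw [continuous_induced_rng]
    constructor
    -- Passing from the compact-open topology to joint continuity is the direction that needs `E` to
    -- be locally compact.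
    · intro h
      exact ContinuousMap.continuous_uncurry_of_continuous ⟨_, h⟩
    · intro h
      exact ContinuousMap.continuous_of_continuous_uncurry _ h
  rw [this]
  exact ⟨fun h n => ⟨fun t => (f t).smooth.of_le (by exact_mod_cast le_top), fun m _ => h m⟩,
    fun h m => (h m).2 m le_rfl⟩

theorem smoothFam_coe [LocallyCompactSpace E] :
    SmoothFam (fun f : SmoothMap E F => (f : E → F)) :=
  continuous_smoothMap_iff.1 continuous_id

end Families

/-! ### Linear equations in the unit quaternions -/

theorem star_mul_self_eq_one {a : ℍ} (ha : ‖a‖ = 1) : star a * a = 1 := by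
  rw [Quaternion.star_mul_self, Quaternion.normSq_eq_norm_mul_self, ha]
  simp

theorem mul_star_self_eq_one {a : ℍ} (ha : ‖a‖ = 1) : a * star a = 1 := by
  rw [Quaternion.self_mul_star, Quaternion.normSq_eq_norm_mul_self, ha]
  simp

theorem norm_eq_one_of_star_mul_self {a : ℍ} (ha : star a * a = 1) : ‖a‖ = 1 := by
  rw [Quaternion.star_mul_self, Quaternion.normSq_eq_norm_mul_self] at ha
  have h : ‖a‖ * ‖a‖ = 1 := by
    have := congrArg (fun q : ℍ => q.re) ha
    simpa using this
  nlinarith [norm_nonneg a]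

/-- Conjugation of quaternions as a continuous linear map. -/
def starCLM : ℍ →L[ℝ] ℍ :=
  LinearMap.toContinuousLinearMap
    { toFun := star
      map_add' := star_add
      map_smul' := fun r a => by simp }

/-- An imaginary `u` satisfies ū = -u. For u = v the product γ̄δ is conserved, which yields unit
norm and uniqueness; for u ≠ v the formula measures how solutions depend on the coefficient. -/
theorem hasDerivAt_star_mul {γ δ u v : ℝ → ℍ} {x : ℝ} (hu : (u x).re = 0)
    (hγ : HasDerivAt γ (u x * γ x) x) (hδ : HasDerivAt δ (v x * δ x) x) :
    HasDerivAt (fun y => star (γ y) * δ y) (star (γ x) * (v x - u x) * δ x) x := by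
  have hs : HasDerivAt (fun y => star (γ y)) (star (u x * γ x)) x :=
    starCLM.hasFDerivAt.comp_hasDerivAt x hγ
  refine (hs.mul hδ).congr_deriv ?_
  rw [star_mul, Quaternion.star_eq_neg.2 hu]
  noncomm_ring

theorem star_mul_eq_of_hasDerivAt {γ δ u : ℝ → ℍ} {s : Set ℝ} (hs : IsOpen s)
    (hs' : IsPreconnected s) (hu : ∀ x ∈ s, (u x).re = 0)
    (hγ : ∀ x ∈ s, HasDerivAt γ (u x * γ x) x) (hδ : ∀ x ∈ s, HasDerivAt δ (u x * δ x) x)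
    {x y : ℝ} (hx : x ∈ s) (hy : y ∈ s) : star (γ x) * δ x = star (γ y) * δ y := by
  have h : ∀ x ∈ s, HasDerivAt (fun y => star (γ y) * δ y) 0 x := fun x hx => by
    simpa using hasDerivAt_star_mul (v := u) (hu x hx) (hγ x hx) (hδ x hx)
  exact hs.is_const_of_deriv_eq_zero hs'
    (fun x hx => (h x hx).differentiableAt.differentiableWithinAt)
    (fun x hx => (h x hx).deriv) hx hy

theorem norm_eq_one_of_hasDerivAt {γ u : ℝ → ℍ} {s : Set ℝ} (hs : IsOpen s)
    (hs' : IsPreconnected s) (hu : ∀ x ∈ s, (u x).re = 0)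
    (hγ : ∀ x ∈ s, HasDerivAt γ (u x * γ x) x) (h0 : (0 : ℝ) ∈ s) (hγ0 : γ 0 = 1)
    {x : ℝ} (hx : x ∈ s) : ‖γ x‖ = 1 := by
  apply norm_eq_one_of_star_mul_self
  rw [star_mul_eq_of_hasDerivAt hs hs' hu hγ hγ hx h0, hγ0]
  simp

theorem eqOn_of_hasDerivAt {γ δ u : ℝ → ℍ} {s : Set ℝ} (hs : IsOpen s)
    (hs' : IsPreconnected s) (hu : ∀ x ∈ s, (u x).re = 0)
    (hγ : ∀ x ∈ s, HasDerivAt γ (u x * γ x) x) (hδ : ∀ x ∈ s, HasDerivAt δ (u x * δ x) x)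
    (h0 : (0 : ℝ) ∈ s) (hγ0 : γ 0 = 1) (hδ0 : δ 0 = 1) : EqOn γ δ s := by
  intro x hx
  have h := star_mul_eq_of_hasDerivAt hs hs' hu hγ hδ hx h0
  rw [hγ0, hδ0, star_one, one_mul] at h
  have := mul_star_self_eq_one (norm_eq_one_of_hasDerivAt hs hs' hu hγ h0 hγ0 hx)
  calc γ x = γ x * (star (γ x) * δ x) := by rw [h, mul_one]
    _ = δ x := by rw [← mul_assoc, this, one_mul]

/-- The map x ↦ x / max(1, ‖x‖) is the identity on the unit ball, bounded by 1 and Lipschitz.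
Inserted in the linear equation, it gives a bounded field, to which Picard–Lindelöf applies on a
whole interval at once. -/
theorem norm_shrink_sub_le {E : Type*} [NormedAddCommGroup E] [NormedSpace ℝ E] (x y : E) :
    ‖(max 1 ‖x‖)⁻¹ • x - (max 1 ‖y‖)⁻¹ • y‖ ≤ 2 * ‖x - y‖ := by
  set a := max 1 ‖x‖
  set b := max 1 ‖y‖
  have ha : 1 ≤ a := le_max_left _ _
  have hb : 1 ≤ b := le_max_left _ _
  have hyb : ‖y‖ ≤ b := le_max_right _ _
  have hab : |b - a| ≤ ‖x - y‖ := by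
    have h := abs_max_sub_max_le_abs ‖x‖ ‖y‖ 1
    rw [max_comm ‖x‖, max_comm ‖y‖, abs_sub_comm] at h
    exact h.trans (abs_norm_sub_norm_le x y)
  have e : a⁻¹ • x - b⁻¹ • y = a⁻¹ • (x - y) + (a⁻¹ * b⁻¹ * (b - a)) • y := by
    have : a⁻¹ * b⁻¹ * (b - a) = a⁻¹ - b⁻¹ := by
      field_simp
    rw [this]
    module
  have ha' : a⁻¹ ≤ 1 := inv_le_one_of_one_le₀ ha
  have ha0 : 0 ≤ a⁻¹ := by positivity
  have hb' : b⁻¹ * ‖y‖ ≤ 1 := by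
    rw [inv_mul_le_iff₀ (by positivity)]
    simpa using hyb
  calc ‖a⁻¹ • x - b⁻¹ • y‖ ≤ ‖a⁻¹ • (x - y)‖ + ‖(a⁻¹ * b⁻¹ * (b - a)) • y‖ := by
        rw [e]; exact norm_add_le _ _
    _ = a⁻¹ * ‖x - y‖ + a⁻¹ * (b⁻¹ * ‖y‖) * |b - a| := by
        rw [norm_smul, norm_smul, norm_mul, norm_mul, Real.norm_of_nonneg ha0,
          Real.norm_of_nonneg (by positivity : 0 ≤ b⁻¹), Real.norm_eq_abs]
        ring
    _ ≤ 1 * ‖x - y‖ + 1 * 1 * ‖x - y‖ := by gcongr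
    _ = 2 * ‖x - y‖ := by ring

theorem norm_shrink_le {E : Type*} [NormedAddCommGroup E] [NormedSpace ℝ E] (x : E) :
    ‖(max 1 ‖x‖)⁻¹ • x‖ ≤ 1 := by
  rw [norm_smul, norm_inv, Real.norm_of_nonneg (by positivity), inv_mul_le_iff₀ (by positivity)]
  simp

theorem exists_hasDerivAt_Ioo {u : ℝ → ℍ} (hu : Continuous u) (hre : ∀ x, (u x).re = 0)
    {M : ℝ} (hM : 0 < M) :
    ∃ γ : ℝ → ℍ, γ 0 = 1 ∧ ∀ x ∈ Ioo (-M) M, HasDerivAt γ (u x * γ x) x := by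
  obtain ⟨C, hC⟩ := (isCompact_Icc (a := -M) (b := M)).exists_bound_of_continuousOn hu.continuousOn
  have hC0 : 0 ≤ C := (norm_nonneg _).trans (hC 0 ⟨by linarith, hM.le⟩)
  -- The truncated field is bounded by C, so a solution on [-M, M] stays within C * M of 1; its
  -- Lipschitz constant is 2C.
  have key : IsPicardLindelof (fun x q => u x * ((max 1 ‖q‖)⁻¹ • q))
      (tmin := -M) (tmax := M) ⟨0, by linarith, hM.le⟩ (1 : ℍ) (C * M).toNNReal 0 C.toNNReal
      (C * 2).toNNReal := by
    refine ⟨fun t ht => ?_, fun q _ => ?_, fun t ht q _ => ?_, ?_⟩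
    · refine LipschitzOnWith.of_dist_le_mul fun x _ y _ => ?_
      rw [dist_eq_norm, dist_eq_norm, ← mul_sub, norm_mul, Real.coe_toNNReal _ (by positivity),
        mul_assoc]
      exact mul_le_mul (hC t ht) (norm_shrink_sub_le x y) (norm_nonneg _) hC0
    · exact (hu.mul continuous_const).continuousOn
    · rw [norm_mul, Real.coe_toNNReal _ hC0]
      simpa using mul_le_mul (hC t ht) (norm_shrink_le q) (norm_nonneg _) hC0
    · rw [Real.coe_toNNReal _ hC0, Real.coe_toNNReal _ (by positivity)]
      simp
  obtain ⟨γ, h0, hγ⟩ := key.exists_eq_forall_mem_Icc_hasDerivWithinAt₀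
  simp only at h0
  have hd : ∀ x ∈ Ioo (-M) M, HasDerivAt γ (((max 1 ‖γ x‖)⁻¹ • u x) * γ x) x := fun x hx => by
    have := (hγ x (Ioo_subset_Icc_self hx)).hasDerivAt (Icc_mem_nhds hx.1 hx.2)
    simpa using this
  refine ⟨γ, h0, fun x hx => ?_⟩
  -- The truncated solution solves a linear equation whose coefficient is a rescaling of `u`, still
  -- imaginary. Hence it has norm one, where the truncation does nothing.
  have h1 : ‖γ x‖ = 1 := norm_eq_one_of_hasDerivAt (u := fun x => (max 1 ‖γ x‖)⁻¹ • u x)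
    isOpen_Ioo isPreconnected_Ioo (fun x _ => by simp [hre]) hd ⟨by linarith, hM⟩ h0 hx
  simpa [h1] using hd x hx

theorem exists_hasDerivAt {u : ℝ → ℍ} (hu : Continuous u) (hre : ∀ x, (u x).re = 0) :
    ∃ γ : ℝ → ℍ, γ 0 = 1 ∧ ∀ x, HasDerivAt γ (u x * γ x) x := by
  -- Half-width n + 1 rather than n: the open interval of index ⌈|x|⌉₊ must contain x, including
  -- when |x| is an integer.
  have hpos : ∀ n : ℕ, (0 : ℝ) < n + 1 := fun n => by positivity
  choose g g0 hg using fun n : ℕ => exists_hasDerivAt_Ioo hu hre (hpos n)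
  have hmono : ∀ m n : ℕ, m ≤ n → EqOn (g m) (g n) (Ioo (-(m + 1 : ℝ)) (m + 1)) := by
    intro m n hmn
    have hmn' : (m : ℝ) ≤ n := by exact_mod_cast hmn
    refine eqOn_of_hasDerivAt isOpen_Ioo isPreconnected_Ioo (fun x _ => hre x) (hg m)
      (fun x hx => hg n x ⟨by linarith [hx.1], by linarith [hx.2]⟩) ⟨?_, ?_⟩ (g0 m) (g0 n)
    · linarith [hpos m]
    · exact hpos m
  have heq : ∀ (n : ℕ), ∀ x ∈ Ioo (-(n + 1 : ℝ)) (n + 1), g ⌈|x|⌉₊ x = g n x := by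
    intro n x hx
    rcases le_total ⌈|x|⌉₊ n with h | h
    · refine hmono _ _ h ?_
      rw [mem_Ioo, ← abs_lt]
      linarith [Nat.le_ceil |x|]
    · exact (hmono _ _ h hx).symm
  refine ⟨fun x => g ⌈|x|⌉₊ x, by simp [g0], fun x => ?_⟩
  have hx : x ∈ Ioo (-((⌈|x|⌉₊ : ℝ) + 1)) (⌈|x|⌉₊ + 1) := by
    rw [mem_Ioo, ← abs_lt]
    linarith [Nat.le_ceil |x|]
  refine (hg _ x hx).congr_of_eventuallyEq ?_
  filter_upwards [Ioo_mem_nhds hx.1 hx.2] with y hy using heq _ y hy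

/-- The solution of `γ' = u γ`, `γ 0 = 1` in the unit quaternions, for imaginary `u`. -/
def quatExp (u : ℝ → ℍ) : ℝ → ℍ :=
  open Classical in
  if h : Continuous u ∧ ∀ x, (u x).re = 0 then (exists_hasDerivAt h.1 h.2).choose else 1

section

variable {u : ℝ → ℍ} (hu : Continuous u) (hre : ∀ x, (u x).re = 0)
include hu hre

theorem quatExp_zero : quatExp u 0 = 1 := by
  rw [quatExp, dif_pos ⟨hu, hre⟩]
  exact (exists_hasDerivAt hu hre).choose_spec.1

theorem hasDerivAt_quatExp (x : ℝ) : HasDerivAt (quatExp u) (u x * quatExp u x) x := by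
  rw [quatExp, dif_pos ⟨hu, hre⟩]
  exact (exists_hasDerivAt hu hre).choose_spec.2 x

theorem norm_quatExp (x : ℝ) : ‖quatExp u x‖ = 1 :=
  norm_eq_one_of_hasDerivAt isOpen_univ isPreconnected_univ (fun x _ => hre x)
    (fun x _ => hasDerivAt_quatExp hu hre x) (mem_univ _) (quatExp_zero hu hre) (mem_univ x)

theorem eq_quatExp {γ : ℝ → ℍ} (h0 : γ 0 = 1) (hγ : ∀ x, HasDerivAt γ (u x * γ x) x) :
    γ = quatExp u :=
  funext fun x => eqOn_of_hasDerivAt isOpen_univ isPreconnected_univ (fun x _ => hre x)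
    (fun x _ => hγ x) (fun x _ => hasDerivAt_quatExp hu hre x) (mem_univ _) h0
    (quatExp_zero hu hre) (mem_univ x)

end

/-! ### Dependence of primitives and of solutions on parameters. -/

section Families

variable {T : Type*} [TopologicalSpace T]

/-- Compare g t x with g s x, then g s x with g s a. By compactness f t is uniformly close to f s on
[-r, r] with r = |a| + 1, and the hypothesis turns this into closeness of g t x and g s x. It is
applied to primitives and to solutions of γ' = uγ. -/
theorem continuous_of_dist_le {F G : Type*} [NormedAddCommGroup F] [NormedAddCommGroup G]
    {f : T → ℝ → F} {g : T → ℝ → G} (hf : Continuous fun p : T × ℝ => f p.1 p.2)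
    (hg : ∀ t, Continuous (g t))
    (h : ∀ s t x C, (∀ y, |y| ≤ |x| → ‖f t y - f s y‖ ≤ C) → ‖g t x - g s x‖ ≤ C * |x|) :
    Continuous fun p : T × ℝ => g p.1 p.2 := by
  rw [continuous_iff_continuousAt]
  rintro ⟨s, a⟩
  rw [ContinuousAt, Metric.tendsto_nhds]
  intro ε hε
  set r := |a| + 1
  have hr : 0 < r := by positivity
  set δ := ε / 4 / r
  have hδ : 0 < δ := by positivity
  have h1 : ∀ᶠ t in 𝓝 s, ∀ y ∈ Icc (-r) r, ‖f t y - f s y‖ < δ := by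
    refine isCompact_Icc.eventually_forall_of_forall_eventually fun y _ => ?_
    have hc : Continuous fun p : T × ℝ => ‖f p.1 p.2 - f s p.2‖ :=
      (hf.sub (hf.comp (continuous_const.prodMk continuous_snd))).norm
    exact hc.continuousAt.eventually_lt_const (by simpa using hδ)
  have h2 : ∀ᶠ x in 𝓝 a, |x| < r := continuous_abs.continuousAt.eventually_lt_const (by simp [r])
  have h3 : ∀ᶠ x in 𝓝 a, dist (g s x) (g s a) < ε / 2 :=
    Metric.tendsto_nhds.1 (hg s).continuousAt _ (by positivity)
  rw [nhds_prod_eq]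
  filter_upwards [h1.prod_mk (h2.and h3)] with p hp
  obtain ⟨hp1, hp2, hp3⟩ := hp
  have h4 : ‖g p.1 p.2 - g s p.2‖ ≤ δ * |p.2| :=
    h _ _ _ _ fun y hy => (hp1 y (abs_le.1 (hy.trans hp2.le))).le
  have h5 : δ * |p.2| ≤ ε / 4 := by
    calc δ * |p.2| ≤ δ * r := by gcongr
      _ = ε / 4 := by simp only [δ]; field_simp
  have h6 := dist_triangle (g p.1 p.2) (g s p.2) (g s a)
  rw [dist_eq_norm (g p.1 p.2) (g s p.2)] at h6
  linarith

theorem norm_sub_le_of_hasDerivAt {F : Type*} [NormedAddCommGroup F] [NormedSpace ℝ F]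
    {f f' : ℝ → F} (hf : ∀ x, HasDerivAt f (f' x) x) {x C : ℝ}
    (h : ∀ y, |y| ≤ |x| → ‖f' y‖ ≤ C) : ‖f x - f 0‖ ≤ C * |x| := by
  have := (convex_Icc (-|x|) |x|).norm_image_sub_le_of_norm_hasDerivWithin_le
    (fun y _ => (hf y).hasDerivWithinAt) (fun y hy => h y (abs_le.2 hy))
    (x := 0) (y := x) ⟨by simp, by simp⟩ ⟨neg_abs_le x, le_abs_self x⟩
  simpa using this

theorem SmoothFam.primitive {f : T → ℝ → ℝ} (hf : SmoothFam f) :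
    SmoothFam (fun t x => ∫ y in (0 : ℝ)..x, f t y) := by
  have hc : ∀ t, Continuous (f t) := fun t => (hf.contDiff t).continuous
  have hd : ∀ t x, HasDerivAt (fun x => ∫ y in (0 : ℝ)..x, f t y) (f t x) x := fun t x =>
    intervalIntegral.integral_hasDerivAt_right ((hc t).intervalIntegrable _ _)
      ((hc t).stronglyMeasurableAtFilter _ _) (hc t).continuousAt
  refine SmoothFam.of_hasDerivAt (continuous_of_dist_le hf.continuous
    (fun t => continuous_iff_continuousAt.2 fun x => (hd t x).continuousAt) ?_) hf hd
  intro s t x C h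
  simpa using norm_sub_le_of_hasDerivAt (fun y => (hd t y).sub (hd s y)) h

theorem SmoothFam.quatExp {u : T → ℝ → ℍ} (hu : SmoothFam u) (hre : ∀ t x, (u t x).re = 0) :
    SmoothFam (fun t => quatExp (u t)) := by
  have hc : ∀ t, Continuous (u t) := fun t => (hu.contDiff t).continuous
  have hd : ∀ t x, HasDerivAt (Bilegendrian.quatExp (u t))
    (u t x * Bilegendrian.quatExp (u t) x) x := fun t => hasDerivAt_quatExp (hc t) (hre t)
  have hcont : Continuous fun p : T × ℝ => Bilegendrian.quatExp (u p.1) p.2 := by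
    refine continuous_of_dist_le hu.continuous
      (fun t => continuous_iff_continuousAt.2 fun x => (hd t x).continuousAt) ?_
    intro s t x C h
    -- The derivative of γ̄ₛγₜ is γ̄ₛ(uₜ - uₛ)γₜ, whose norm is ‖uₜ - uₛ‖. Multiplication by the
    -- unit quaternion γₛ then turns γ̄ₛγₜ - 1 into γₜ - γₛ, so no Gronwall estimate is needed.
    have h1 := norm_sub_le_of_hasDerivAt (x := x) (C := C)
      (fun y => hasDerivAt_star_mul (hre s y) (hd s y) (hd t y)) (fun y hy => by
        simpa [norm_quatExp (hc s) (hre s), norm_quatExp (hc t) (hre t)] using h y hy)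
    rw [quatExp_zero (hc s) (hre s), quatExp_zero (hc t) (hre t)] at h1
    have h2 := norm_quatExp (hc s) (hre s) x
    have h3 : Bilegendrian.quatExp (u t) x - Bilegendrian.quatExp (u s) x =
        Bilegendrian.quatExp (u s) x *
        (star (Bilegendrian.quatExp (u s) x) * Bilegendrian.quatExp (u t) x - star 1 * 1) := by
      rw [mul_sub, ← mul_assoc, mul_star_self_eq_one h2]
      simp
    rw [h3, norm_mul, h2, one_mul]
    exact h1
  -- Bootstrap: γ' = uγ gains one order of regularity at each step.
  have key : ∀ n, FamContDiff n (fun t => Bilegendrian.quatExp (u t)) := by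
    intro n
    induction n with
    | zero => exact famContDiff_zero.2 hcont
    | succ n ih =>
      exact FamContDiff.of_hasDerivAt hcont ((hu n).bilinear (ContinuousLinearMap.mul ℝ ℍ) ih) hd
  exact key

end Families

/-! ### Quaternion algebra -/

@[simp] theorem qi_re : qi.re = 0 := rfl
@[simp] theorem qi_imI : qi.imI = 1 := rfl
@[simp] theorem qi_imJ : qi.imJ = 0 := rfl
@[simp] theorem qi_imK : qi.imK = 0 := rfl
@[simp] theorem qj_re : qj.re = 0 := rfl
@[simp] theorem qj_imI : qj.imI = 0 := rfl
@[simp] theorem qj_imJ : qj.imJ = 1 := rfl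
@[simp] theorem qj_imK : qj.imK = 0 := rfl
@[simp] theorem qk_re : qk.re = 0 := rfl
@[simp] theorem qk_imI : qk.imI = 0 := rfl
@[simp] theorem qk_imJ : qk.imJ = 0 := rfl
@[simp] theorem qk_imK : qk.imK = 1 := rfl

theorem inner_quaternion (a b : ℍ) :
    inner ℝ a b = a.re * b.re + a.imI * b.imI + a.imJ * b.imJ + a.imK * b.imK := by
  rw [Quaternion.inner_def]
  simp

theorem inner_mul_left_of_norm_eq_one {c : ℍ} (hc : ‖c‖ = 1) (a b : ℍ) :
    inner ℝ (c * a) (c * b) = inner ℝ a b := by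
  have h : ‖c‖ * ‖c‖ = 1 := by rw [hc, one_mul]
  rw [← Quaternion.normSq_eq_norm_mul_self, Quaternion.normSq_def'] at h
  simp only [inner_quaternion, Quaternion.re_mul, Quaternion.imI_mul, Quaternion.imJ_mul,
    Quaternion.imK_mul]
  linear_combination (a.re * b.re + a.imI * b.imI + a.imJ * b.imJ + a.imK * b.imK) * h

theorem inner_mul_right_of_norm_eq_one {d : ℍ} (hd : ‖d‖ = 1) (a b : ℍ) :
    inner ℝ (a * d) (b * d) = inner ℝ a b := by
  have h : ‖d‖ * ‖d‖ = 1 := by rw [hd, one_mul]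
  rw [← Quaternion.normSq_eq_norm_mul_self, Quaternion.normSq_def'] at h
  simp only [inner_quaternion, Quaternion.re_mul, Quaternion.imI_mul, Quaternion.imJ_mul,
    Quaternion.imK_mul]
  linear_combination (a.re * b.re + a.imI * b.imI + a.imJ * b.imJ + a.imK * b.imK) * h

theorem norm_qk : ‖qk‖ = 1 := by
  have : ‖qk‖ * ‖qk‖ = 1 := by
    rw [← Quaternion.normSq_eq_norm_mul_self, Quaternion.normSq_def']
    simp
  nlinarith [norm_nonneg qk]

/-- Polarization of aā = |a|²; for orthogonal vectors it becomes the exchange rule ab̄ = -bā. -/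
theorem mul_star_add_mul_star (a b : ℍ) : a * star b + b * star a = ((2 * inner ℝ a b : ℝ) : ℍ) := by
  rw [inner_quaternion]
  ext <;> simp <;> ring

theorem star_mul_add_star_mul (a b : ℍ) : star a * b + star b * a = ((2 * inner ℝ a b : ℝ) : ℍ) := by
  rw [inner_quaternion]
  ext <;> simp <;> ring

/-- Multiplication on the left by `c` and on the right by `d`, for unit quaternions. -/
def sandwich (c d : ℍ) (hc : ‖c‖ = 1) (hd : ‖d‖ = 1) : ℍ ≃ₗᵢ[ℝ] ℍ where
  toFun q := c * q * d
  invFun q := star c * q * star d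
  map_add' a b := by noncomm_ring
  map_smul' r a := by simp
  left_inv q := by
    change star c * (c * q * d) * star d = q
    calc star c * (c * q * d) * star d = (star c * c) * q * (d * star d) := by noncomm_ring
      _ = q := by rw [star_mul_self_eq_one hc, mul_star_self_eq_one hd, one_mul, mul_one]
  right_inv q := by
    change c * (star c * q * star d) * d = q
    calc c * (star c * q * star d) * d = (c * star c) * q * (star d * d) := by noncomm_ring
      _ = q := by rw [mul_star_self_eq_one hc, star_mul_self_eq_one hd, one_mul, mul_one]
  norm_map' q := by
    change ‖c * q * d‖ = ‖q‖
    rw [norm_mul, norm_mul, hc, hd, one_mul, mul_one]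

@[simp]
theorem sandwich_apply {c d : ℍ} (hc : ‖c‖ = 1) (hd : ‖d‖ = 1) (q : ℍ) :
    sandwich c d hc hd q = c * q * d := rfl

/-! ### The volume form under linear maps and multiplications. -/

/-- The standard basis of the quaternions. -/
def quatBasis : Module.Basis (Fin 4) ℝ ℍ := QuaternionAlgebra.basisOneIJK (-1 : ℝ) 0 (-1)

theorem vol_eq_det (a b c d : ℍ) :
    vol a b c d = quatBasis.det ![a, b, c, d] := by
  rw [Module.Basis.det_apply, ← Matrix.det_transpose, vol]
  congr 1
  ext i j
  fin_cases i <;> fin_cases j <;> rfl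

theorem vol_map (R : ℍ →ₗ[ℝ] ℍ) (a b c d : ℍ) :
    vol (R a) (R b) (R c) (R d) = LinearMap.det R * vol a b c d := by
  rw [vol_eq_det, vol_eq_det, ← Module.Basis.det_comp]
  congr 1
  funext i
  fin_cases i <;> rfl

/-- By `vol_map` only the determinant of the multiplication is needed, and it is read off on the
basis 1, i, j, k. -/
theorem vol_mul_left (q a b c d : ℍ) :
    vol (q * a) (q * b) (q * c) (q * d) = (Quaternion.normSq q) ^ 2 * vol a b c d := by
  have h := vol_map (LinearMap.mulLeft ℝ q)
  have h1 := h 1 qi qj qk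
  have e1 : vol 1 qi qj qk = 1 := by
    simp [vol, Matrix.det_succ_row_zero, Fin.sum_univ_succ]
  have e2 : vol (q * 1) (q * qi) (q * qj) (q * qk) = (Quaternion.normSq q) ^ 2 := by
    rw [Quaternion.normSq_def']
    simp [vol, Matrix.det_succ_row_zero, Fin.sum_univ_succ, Fin.succAbove]
    ring
  simp only [LinearMap.mulLeft_apply] at h h1
  rw [e1, e2, mul_one] at h1
  rw [h, h1]

theorem vol_mul_right (q a b c d : ℍ) :
    vol (a * q) (b * q) (c * q) (d * q) = (Quaternion.normSq q) ^ 2 * vol a b c d := by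
  have h := vol_map (LinearMap.mulRight ℝ q)
  have h1 := h 1 qi qj qk
  have e1 : vol 1 qi qj qk = 1 := by
    simp [vol, Matrix.det_succ_row_zero, Fin.sum_univ_succ]
  have e2 : vol (1 * q) (qi * q) (qj * q) (qk * q) = (Quaternion.normSq q) ^ 2 := by
    rw [Quaternion.normSq_def']
    simp [vol, Matrix.det_succ_row_zero, Fin.sum_univ_succ, Fin.succAbove]
    ring
  simp only [LinearMap.mulRight_apply] at h h1
  rw [e1, e2, mul_one] at h1
  rw [h, h1]

theorem vol_sandwich {c d : ℍ} (hc : ‖c‖ = 1) (hd : ‖d‖ = 1) (x y z w : ℍ) :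
    vol (c * x * d) (c * y * d) (c * z * d) (c * w * d) = vol x y z w := by
  rw [vol_mul_right, vol_mul_left, Quaternion.normSq_eq_norm_mul_self,
    Quaternion.normSq_eq_norm_mul_self, hc, hd]
  ring

theorem sandwich_mem_SOH {c d : ℍ} (hc : ‖c‖ = 1) (hd : ‖d‖ = 1) :
    sandwich c d hc hd ∈ SOH := by
  have h := vol_map ((sandwich c d hc hd).toLinearEquiv : ℍ →ₗ[ℝ] ℍ) 1 qi qj qk
  have e1 : vol 1 qi qj qk = 1 := by
    simp [vol, Matrix.det_succ_row_zero, Fin.sum_univ_succ]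
  have h' := vol_sandwich hc hd 1 qi qj qk
  change LinearMap.det ((sandwich c d hc hd).toLinearEquiv : ℍ →ₗ[ℝ] ℍ) = 1
  rw [e1] at h h'
  rw [mul_one] at h
  exact h.symm.trans h'

theorem vol_of_mem_SOH {R : ℍ ≃ₗᵢ[ℝ] ℍ} (hR : R ∈ SOH) (a b c d : ℍ) :
    vol (R a) (R b) (R c) (R d) = vol a b c d := by
  have h := vol_map (R.toLinearEquiv : ℍ →ₗ[ℝ] ℍ) a b c d
  change LinearMap.det (R.toLinearEquiv : ℍ →ₗ[ℝ] ℍ) = 1 at hR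
  rw [hR, one_mul] at h
  exact h

/-! ### The plane of i and j, and normalization by conjugation. -/

/-- The embedding of the complex plane as the plane spanned by `i` and `j`. -/
def ij : ℂ →L[ℝ] ℍ :=
  LinearMap.toContinuousLinearMap
    { toFun := fun z => z.re • qi + z.im • qj
      map_add' := fun z w => by
        simp only [Complex.add_re, Complex.add_im]
        module
      map_smul' := fun r z => by
        simp only [Complex.real_smul, Complex.re_ofReal_mul, Complex.im_ofReal_mul,
          RingHom.id_apply]
        module }

theorem ij_apply (z : ℂ) : ij z = z.re • qi + z.im • qj := rfl

@[simp] theorem ij_re (z : ℂ) : (ij z).re = 0 := by simp [ij_apply]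
@[simp] theorem ij_imI (z : ℂ) : (ij z).imI = z.re := by simp [ij_apply]
@[simp] theorem ij_imJ (z : ℂ) : (ij z).imJ = z.im := by simp [ij_apply]
@[simp] theorem ij_imK (z : ℂ) : (ij z).imK = 0 := by simp [ij_apply]

/-- Left multiplication by k is the complex structure of the plane; on the right it is the opposite
one. This sign accounts for the two eigenvalues of J on products of curves. -/
theorem qk_mul_ij (z : ℂ) : qk * ij z = ij (Complex.I * z) := by
  ext <;> simp

theorem ij_mul_qk (z : ℂ) : ij z * qk = ij (-(Complex.I * z)) := by
  ext <;> simp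

theorem star_ij (z : ℂ) : star (ij z) = -ij z := by
  ext <;> simp

theorem inner_ij (z w : ℂ) : inner ℝ (ij z) (ij w) = z.re * w.re + z.im * w.im := by
  rw [inner_quaternion]
  simp

theorem norm_ij (z : ℂ) : ‖ij z‖ = ‖z‖ := by
  have h : ‖ij z‖ * ‖ij z‖ = ‖z‖ * ‖z‖ := by
    rw [← real_inner_self_eq_norm_mul_norm, inner_ij, ← sq ‖z‖, ← Complex.normSq_eq_norm_sq,
      Complex.normSq_apply]
  nlinarith [norm_nonneg (ij z), norm_nonneg z]

theorem vol_one_ij_ij_qk (z w : ℂ) : vol 1 (ij z) (ij w) qk = z.re * w.im - z.im * w.re := by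
  simp [vol, Matrix.det_succ_row_zero, Fin.sum_univ_succ, Fin.succAbove]
  ring

theorem exp_smul_qk_mul_qi (θ : ℝ) :
    NormedSpace.exp (θ • qk) * qi = ij (Complex.exp (θ * Complex.I)) := by
  have hn : ‖θ • qk‖ = |θ| := by rw [norm_smul, norm_qk, mul_one, Real.norm_eq_abs]
  rw [Quaternion.exp_of_re_eq_zero _ (by simp), hn, Real.cos_abs]
  have h : Real.sin |θ| / |θ| * θ = Real.sin θ := by
    rcases abs_cases θ with ⟨h, _⟩ | ⟨h, h'⟩
    · rw [h]
      rcases eq_or_ne θ 0 with rfl | h0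
      · simp
      · field_simp
    · rw [h, Real.sin_neg]
      have := h'.ne
      field_simp
  rw [smul_smul, h]
  ext <;> simp [Complex.exp_ofReal_mul_I_re, Complex.exp_ofReal_mul_I_im]

/-- Since n² = k² = -1, the quaternion 1 - kn intertwines n and k: (1 - kn)n = n + k = k(1 - kn). It
vanishes only for n = -k, in which case conjugation by i works. -/
theorem exists_conj_eq_qk {n : ℍ} (hn : ‖n‖ = 1) (hre : n.re = 0) :
    ∃ c : ℍ, ‖c‖ = 1 ∧ c * n * star c = qk := by
  have hsq : n * n = -1 := by
    have := mul_star_self_eq_one hn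
    rw [Quaternion.star_eq_neg.2 hre, mul_neg] at this
    rw [← this, neg_neg]
  have hk : qk * qk = -1 := by ext <;> simp
  by_cases h : 1 - qk * n = 0
  · have h' : n = -qk := by
      have : qk * (1 - qk * n) = 0 := by rw [h, mul_zero]
      rw [mul_sub, ← mul_assoc, hk] at this
      rw [mul_one, neg_one_mul, sub_neg_eq_add, add_comm] at this
      exact eq_neg_of_add_eq_zero_left this
    refine ⟨qi, ?_, ?_⟩
    · have := norm_ij 1
      simpa [ij_apply] using this
    · rw [h']
      ext <;> simp
  · have hpos : ‖1 - qk * n‖ ≠ 0 := norm_ne_zero_iff.2 h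
    have hc : ‖(‖1 - qk * n‖⁻¹ • (1 - qk * n))‖ = 1 := by
      rw [norm_smul, norm_inv, norm_norm, inv_mul_cancel₀ hpos]
    refine ⟨‖1 - qk * n‖⁻¹ • (1 - qk * n), hc, ?_⟩
    have e : (1 - qk * n) * n = qk * (1 - qk * n) := by
      rw [sub_mul, mul_sub, mul_assoc, hsq, ← mul_assoc qk qk, hk]
      noncomm_ring
    have e' : (‖1 - qk * n‖⁻¹ • (1 - qk * n)) * n = qk * (‖1 - qk * n‖⁻¹ • (1 - qk * n)) := by
      rw [smul_mul_assoc, e, mul_smul_comm]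
    rw [e', mul_assoc, mul_star_self_eq_one hc, mul_one]

/-- Once n is sent to k, the vector v lands on the unit circle of the plane of i and j, at some
angle β. Conjugation by e^{-βk/2} fixes k and turns this plane by -β. -/
theorem exists_conj_eq_qk_qi {n v : ℍ} (hn : ‖n‖ = 1) (hnre : n.re = 0) (hv : ‖v‖ = 1)
    (hvre : v.re = 0) (hnv : inner ℝ v n = 0) :
    ∃ c : ℍ, ‖c‖ = 1 ∧ c * n * star c = qk ∧ c * v * star c = qi := by
  obtain ⟨c, hc, hcn⟩ := exists_conj_eq_qk hn hnre
  have hcs : ‖star c‖ = 1 := by rw [Quaternion.norm_star, hc]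
  set w := c * v * star c with hw
  have hw1 : ‖w‖ = 1 := by rw [hw, norm_mul, norm_mul, hc, hv, hcs]; norm_num
  have hwk : w.imK = 0 := by
    have : inner ℝ w qk = 0 := by
      rw [hw, ← hcn, inner_mul_right_of_norm_eq_one hcs, inner_mul_left_of_norm_eq_one hc, hnv]
    rw [inner_quaternion] at this
    simpa using this
  have hwre : w.re = 0 := by
    have : inner ℝ w 1 = 0 := by
      rw [hw, ← mul_star_self_eq_one hc, ← mul_one c, inner_mul_right_of_norm_eq_one
        (by simpa using hcs), mul_one, ← mul_one c, mul_assoc,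
        inner_mul_left_of_norm_eq_one (by simpa using hc), inner_quaternion]
      simp [hvre]
    rw [inner_quaternion] at this
    simpa using this
  set z : ℂ := ⟨w.imI, w.imJ⟩ with hz
  have hwz : w = ij z := by ext <;> simp [hz, hwk, hwre]
  have hz1 : ‖z‖ = 1 := by rw [← norm_ij, ← hwz, hw1]
  set β := Complex.arg z
  have hzβ : z = Complex.exp (β * Complex.I) := by
    have := Complex.norm_mul_exp_arg_mul_I z
    rw [hz1] at this
    simpa using this.symm
  obtain ⟨d, hd0, hd1, hd2, hd3⟩ : ∃ d : ℍ, d.re = cos (β / 2) ∧ d.imI = 0 ∧ d.imJ = 0 ∧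
    d.imK = -sin (β / 2) := ⟨⟨_, _, _, _⟩, rfl, rfl, rfl, rfl⟩
  have hd : ‖d‖ = 1 := by
    have : ‖d‖ * ‖d‖ = 1 := by
      rw [← Quaternion.normSq_eq_norm_mul_self, Quaternion.normSq_def']
      simp [hd0, hd1, hd2, hd3]
    nlinarith [norm_nonneg d]
  have hdk : d * qk * star d = qk := by
    have : d * qk = qk * d := by ext <;> simp [hd0, hd1, hd2, hd3]
    rw [this, mul_assoc, mul_star_self_eq_one hd, mul_one]
  have hdw : d * w * star d = qi := by
    have hcos : Real.cos β = 2 * Real.cos (β / 2) ^ 2 - 1 := by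
      rw [← Real.cos_two_mul]; congr 1; ring
    have hsin : Real.sin β = 2 * Real.sin (β / 2) * Real.cos (β / 2) := by
      rw [← Real.sin_two_mul]; congr 1; ring
    have h1 := Real.sin_sq_add_cos_sq (β / 2)
    rw [hwz, hzβ]
    ext
    · simp [hd0, hd1, hd2, hd3]
    · simp [hd0, hd1, hd2, hd3, Complex.exp_ofReal_mul_I_re, Complex.exp_ofReal_mul_I_im, hcos, hsin]
      linear_combination (2 * Real.cos (β / 2) ^ 2 + 1) * h1
    · simp [hd0, hd1, hd2, hd3, Complex.exp_ofReal_mul_I_re, Complex.exp_ofReal_mul_I_im, hcos, hsin]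
      linear_combination (-(2 * Real.sin (β / 2) * Real.cos (β / 2))) * h1
    · simp [hd0, hd1, hd2, hd3]
  refine ⟨d * c, by rw [norm_mul, hd, hc, one_mul], ?_, ?_⟩
  · rw [star_mul, ← hdk, ← hcn]
    noncomm_ring
  · rw [star_mul, ← hdw, hw]
    noncomm_ring

/-! ### Products of curves -/

/-- The map `(x₁, x₂) ↦ (γ₂(x₂) γ₁(x₁), γ₂(x₂) k γ₁(x₁))`. -/
def prodMap (γ₁ γ₂ : ℝ → ℍ) (p : ℝ × ℝ) : ℍ × ℍ :=
  (γ₂ p.2 * γ₁ p.1, γ₂ p.2 * qk * γ₁ p.1)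

theorem hasFDerivAt_comp_fst {F : Type*} [NormedAddCommGroup F] [NormedSpace ℝ F]
    {γ : ℝ → F} {γ' : F} {p : ℝ × ℝ} (h : HasDerivAt γ γ' p.1) :
    HasFDerivAt (fun q : ℝ × ℝ => γ q.1)
      ((ContinuousLinearMap.fst ℝ ℝ ℝ).smulRight γ') p := by
  refine (h.hasFDerivAt.comp p hasFDerivAt_fst).congr_fderiv ?_
  ext <;> simp

theorem hasFDerivAt_comp_snd {F : Type*} [NormedAddCommGroup F] [NormedSpace ℝ F]
    {γ : ℝ → F} {γ' : F} {p : ℝ × ℝ} (h : HasDerivAt γ γ' p.2) :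
    HasFDerivAt (fun q : ℝ × ℝ => γ q.2)
      ((ContinuousLinearMap.snd ℝ ℝ ℝ).smulRight γ') p := by
  refine (h.hasFDerivAt.comp p hasFDerivAt_snd).congr_fderiv ?_
  ext <;> simp

theorem fderiv_prodMap_apply {γ₁ γ₂ : ℝ → ℍ} {γ₁' γ₂' : ℍ} {p : ℝ × ℝ}
    (h₁ : HasDerivAt γ₁ γ₁' p.1) (h₂ : HasDerivAt γ₂ γ₂' p.2) (v : ℝ × ℝ) :
    fderiv ℝ (prodMap γ₁ γ₂) p v =
      (v.1 • (γ₂ p.2 * γ₁') + v.2 • (γ₂' * γ₁ p.1),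
        v.1 • (γ₂ p.2 * qk * γ₁') + v.2 • (γ₂' * qk * γ₁ p.1)) := by
  have hf := hasFDerivAt_comp_fst h₁
  have hs := hasFDerivAt_comp_snd h₂
  have := ((hs.mul' hf).prodMk ((hs.mul_const' qk).mul' hf)).fderiv
  rw [show fderiv ℝ (prodMap γ₁ γ₂) p = _ from this]
  refine Prod.ext ?_ ?_
  · simp
  · simp

/-- Curves in the unit quaternions that start at `1` and have velocities `ζ₁ γ₁` and `γ₂ ζ₂` for
unit vectors `ζ₁`, `ζ₂` in the plane spanned by `i` and `j`. -/
structure IsFrame (ζ₁ ζ₂ : ℝ → ℂ) (γ₁ γ₂ : ℝ → ℍ) : Prop where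
  smooth₁ : ContDiff ℝ ∞ γ₁
  smooth₂ : ContDiff ℝ ∞ γ₂
  norm₁ : ∀ x, ‖γ₁ x‖ = 1
  norm₂ : ∀ x, ‖γ₂ x‖ = 1
  zero₁ : γ₁ 0 = 1
  zero₂ : γ₂ 0 = 1
  norm_dir₁ : ∀ x, ‖ζ₁ x‖ = 1
  norm_dir₂ : ∀ x, ‖ζ₂ x‖ = 1
  hasDerivAt₁ : ∀ x, HasDerivAt γ₁ (ij (ζ₁ x) * γ₁ x) x
  hasDerivAt₂ : ∀ x, HasDerivAt γ₂ (γ₂ x * ij (ζ₂ x)) x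

namespace IsFrame

variable {ζ₁ ζ₂ : ℝ → ℂ} {γ₁ γ₂ : ℝ → ℍ} (h : IsFrame ζ₁ ζ₂ γ₁ γ₂)
include h

theorem contDiff_prodMap : ContDiff ℝ ∞ (prodMap γ₁ γ₂) :=
  ((h.smooth₂.comp contDiff_snd).mul (h.smooth₁.comp contDiff_fst)).prodMk
    (((h.smooth₂.comp contDiff_snd).mul contDiff_const).mul (h.smooth₁.comp contDiff_fst))

/-- Since k anticommutes with i and j, moving it past ζ₂ changes the sign of the x₂ term in the
second component. As q ↦ γ₂qγ₁ is an isometry preserving volume, the bilegendrian and normalization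
conditions reduce to identities between complex numbers. -/
theorem fderiv_prodMap (p v : ℝ × ℝ) :
    fderiv ℝ (prodMap γ₁ γ₂) p v =
      (γ₂ p.2 * ij (v.1 • ζ₁ p.1 + v.2 • ζ₂ p.2) * γ₁ p.1,
        γ₂ p.2 * ij (Complex.I * (v.1 • ζ₁ p.1 - v.2 • ζ₂ p.2)) * γ₁ p.1) := by
  rw [fderiv_prodMap_apply (h.hasDerivAt₁ p.1) (h.hasDerivAt₂ p.2)]
  refine Prod.ext ?_ ?_
  · simp only [map_add, map_smul, mul_add, add_mul, mul_smul_comm, smul_mul_assoc, mul_assoc]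
  · simp only [mul_sub, map_sub, mul_smul_comm, map_smul, ← qk_mul_ij, smul_mul_assoc, mul_assoc,
      sub_mul]
    rw [← mul_assoc (ij _) qk, ij_mul_qk, map_neg, ← qk_mul_ij]
    simp only [neg_mul, mul_neg, smul_neg, ← sub_eq_add_neg, mul_assoc]

theorem inner_sandwich (p : ℝ × ℝ) (a b : ℍ) :
    inner ℝ (γ₂ p.2 * a * γ₁ p.1) (γ₂ p.2 * b * γ₁ p.1) = inner ℝ a b := by
  rw [inner_mul_right_of_norm_eq_one (h.norm₁ _), inner_mul_left_of_norm_eq_one (h.norm₂ _)]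

theorem inner_prodMap_fst (p : ℝ × ℝ) (a : ℍ) :
    inner ℝ (γ₂ p.2 * a * γ₁ p.1) (γ₂ p.2 * γ₁ p.1) = a.re := by
  have := h.inner_sandwich p a 1
  rw [mul_one] at this
  rw [this, inner_quaternion]
  simp

theorem rotA_prodMap (p : ℝ × ℝ) (z : ℂ) :
    rotA (prodMap γ₁ γ₂ p) (γ₂ p.2 * ij z * γ₁ p.1) = γ₂ p.2 * ij (Complex.I * z) * γ₁ p.1 := by
  rw [rotA, prodMap, ← qk_mul_ij, star_mul]
  calc γ₂ p.2 * qk * γ₁ p.1 * (star (γ₁ p.1) * star (γ₂ p.2)) * (γ₂ p.2 * ij z * γ₁ p.1)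
      = γ₂ p.2 * qk * (γ₁ p.1 * star (γ₁ p.1)) * (star (γ₂ p.2) * γ₂ p.2) * ij z * γ₁ p.1 := by
        noncomm_ring
    _ = _ := by
        rw [mul_star_self_eq_one (h.norm₁ _), star_mul_self_eq_one (h.norm₂ _)]
        simp only [mul_one, mul_assoc]

theorem gHat_prodMap (p v w : ℝ × ℝ) :
    gHat (fderiv ℝ (prodMap γ₁ γ₂) p v) (fderiv ℝ (prodMap γ₁ γ₂) p w) =
      2 * (v.1 * w.1 + v.2 * w.2) := by
  have h1 : (ζ₁ p.1).re ^ 2 + (ζ₁ p.1).im ^ 2 = 1 := by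
    have := Complex.sq_norm (ζ₁ p.1)
    rw [h.norm_dir₁, Complex.normSq_apply] at this
    linarith
  have h2 : (ζ₂ p.2).re ^ 2 + (ζ₂ p.2).im ^ 2 = 1 := by
    have := Complex.sq_norm (ζ₂ p.2)
    rw [h.norm_dir₂, Complex.normSq_apply] at this
    linarith
  rw [h.fderiv_prodMap, h.fderiv_prodMap, gHat]
  simp only [h.inner_sandwich, inner_ij]
  simp
  linear_combination (2 * v.1 * w.1) * h1 + (2 * v.2 * w.2) * h2

theorem isNormalized : IsNormalized (prodMap γ₁ γ₂) where
  metric := h.gHat_prodMap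
  eigen₁ p := by
    rw [endoJ, h.fderiv_prodMap, h.rotA_prodMap, h.rotA_prodMap]
    simp [d1, ← mul_assoc]
  eigen₂ p := by
    rw [endoJ, h.fderiv_prodMap, h.rotA_prodMap, h.rotA_prodMap]
    simp [d2, ← mul_assoc]

theorem vol_prodMap (p : ℝ × ℝ) (z w : ℂ) :
    vol (prodMap γ₁ γ₂ p).1 (γ₂ p.2 * ij z * γ₁ p.1) (γ₂ p.2 * ij w * γ₁ p.1)
      (prodMap γ₁ γ₂ p).2 = z.re * w.im - z.im * w.re := by
  have := vol_sandwich (h.norm₂ p.2) (h.norm₁ p.1) 1 (ij z) (ij w) qk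
  rw [vol_one_ij_ij_qk, mul_one] at this
  exact this

theorem isBilegendrianImmersion : IsBilegendrianImmersion (prodMap γ₁ γ₂) where
  smooth := h.contDiff_prodMap
  mem_US3 p := by
    have e1 := h.inner_sandwich p 1 1
    have e2 := h.inner_sandwich p qk qk
    have e3 := h.inner_sandwich p 1 qk
    rw [mul_one] at e1 e3
    exact ⟨e1.trans (by simp), e2.trans (by simp [norm_qk]),
      e3.trans (by simp [inner_quaternion])⟩
  immersion p := by
    rw [injective_iff_map_eq_zero]
    intro v hv
    -- The pullback of ĝ is definite, so φ is an immersion even where X alone fails to be one.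
    have := h.gHat_prodMap p v v
    rw [hv] at this
    simp only [gHat, Prod.fst_zero, inner_self_eq_norm_sq_to_K, Prod.snd_zero] at this
    simp at this
    refine Prod.ext ?_ ?_ <;> simp <;> nlinarith [mul_self_nonneg v.1, mul_self_nonneg v.2]
  integral p v := by
    rw [h.fderiv_prodMap]
    refine ⟨?_, ?_, ?_, ?_⟩
    · rw [prodMap, h.inner_prodMap_fst, ij_re]
    · rw [prodMap, h.inner_sandwich, inner_quaternion]
      simp
    · rw [prodMap, h.inner_prodMap_fst, ij_re]
    · rw [prodMap, h.inner_sandwich, inner_quaternion]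
      simp
  legendrianI p v w := by
    rw [h.fderiv_prodMap, h.fderiv_prodMap, omegaI]
    simp only [h.inner_sandwich, inner_ij]
    simp
    ring
  legendrianK p v w := by
    rw [h.fderiv_prodMap, h.fderiv_prodMap, omegaK]
    simp only [h.vol_prodMap]
    simp
    ring

theorem isFactorization : IsFactorization (prodMap γ₁ γ₂) 1 qk γ₁ γ₂ where
  smooth₁ := h.smooth₁
  smooth₂ := h.smooth₂
  mem₁ := h.norm₁
  mem₂ := h.norm₂
  zero₁ := h.zero₁
  zero₂ := h.zero₂
  eq p := by rw [mul_one]; rfl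

end IsFrame

/-! ### The invariant of a bilegendrian immersion -/

/-- The function `⟨∂₁X, ∂₂X⟩ + i ⟨∂₁Y, ∂₂X⟩`. -/
def angleInvariant (φ : ℝ × ℝ → ℍ × ℍ) (p : ℝ × ℝ) : ℂ :=
  (inner ℝ (fderiv ℝ φ p d1).1 (fderiv ℝ φ p d2).1 : ℝ) +
    (inner ℝ (fderiv ℝ φ p d1).2 (fderiv ℝ φ p d2).1 : ℝ) * Complex.I

theorem fderiv_postcomp (R : ℍ ≃ₗᵢ[ℝ] ℍ) {φ : ℝ × ℝ → ℍ × ℍ} {p : ℝ × ℝ}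
    (hφ : DifferentiableAt ℝ φ p) (v : ℝ × ℝ) :
    fderiv ℝ (postcomp R φ) p v = (R (fderiv ℝ φ p v).1, R (fderiv ℝ φ p v).2) := by
  have h1 := (R.toContinuousLinearEquiv : ℍ →L[ℝ] ℍ).hasFDerivAt.comp p hφ.hasFDerivAt.fst
  have h2 := (R.toContinuousLinearEquiv : ℍ →L[ℝ] ℍ).hasFDerivAt.comp p hφ.hasFDerivAt.snd
  rw [show fderiv ℝ (postcomp R φ) p = _ from (h1.prodMk h2).fderiv]
  rfl

theorem angleInvariant_postcomp (R : ℍ ≃ₗᵢ[ℝ] ℍ) {φ : ℝ × ℝ → ℍ × ℍ} (hφ : Differentiable ℝ φ) :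
    angleInvariant (postcomp R φ) = angleInvariant φ := by
  funext p
  simp only [angleInvariant, fderiv_postcomp R (hφ p), R.inner_map_map]

theorem IsFrame.angleInvariant {ζ₁ ζ₂ : ℝ → ℂ} {γ₁ γ₂ : ℝ → ℍ} (h : IsFrame ζ₁ ζ₂ γ₁ γ₂)
    (p : ℝ × ℝ) : angleInvariant (prodMap γ₁ γ₂) p = ζ₂ p.2 * star (ζ₁ p.1) := by
  rw [Bilegendrian.angleInvariant, h.fderiv_prodMap, h.fderiv_prodMap]
  simp only [h.inner_sandwich, inner_ij]
  apply Complex.ext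
  · simp [d1, d2]
    ring
  · simp [d1, d2]
    ring

/-- Adding and subtracting the two frame equations expresses ∂₁φ and ∂₂φ in e₁, e₂, and the inner
products become cos 2θ and sin 2θ. Thus e^{2iθ}, and with it dθ, does not depend on the choice of
the angle function or frame. -/
theorem IsAngleFunction.angleInvariant {φ : ℝ × ℝ → ℍ × ℍ} {θ : ℝ × ℝ → ℝ}
    (h : IsAngleFunction φ θ) (p : ℝ × ℝ) :
    angleInvariant φ p = Complex.exp ((2 * θ p : ℝ) * Complex.I) := by
  obtain ⟨-, e₁, e₂, -, -, h⟩ := h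
  obtain ⟨ho, -, ha, hb⟩ := h p
  have e11 : inner ℝ (e₁ p) (e₁ p) = (1 : ℝ) := by
    have := ho.1 1
    rw [real_inner_self_eq_norm_sq]
    simp at this
    simp [this]
  have e22 : inner ℝ (e₂ p) (e₂ p) = (1 : ℝ) := by
    have := ho.1 2
    rw [real_inner_self_eq_norm_sq]
    simp at this
    simp [this]
  have e12 : inner ℝ (e₁ p) (e₂ p) = (0 : ℝ) := ho.2 (i := 1) (j := 2) (by decide)
  have e21 : inner ℝ (e₂ p) (e₁ p) = (0 : ℝ) := ho.2 (i := 2) (j := 1) (by decide)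
  have h1 : fderiv ℝ φ p d1 = (cos (θ p) • e₁ p - sin (θ p) • e₂ p,
      sin (θ p) • e₁ p + cos (θ p) • e₂ p) := by
    have : d1 = (1 / 2 : ℝ) • (d1 + d2) + (1 / 2 : ℝ) • (d1 - d2) := by module
    rw [this, map_add, ha, hb]
    refine Prod.ext ?_ ?_ <;> simp [sub_eq_add_neg]
  have h2 : fderiv ℝ φ p d2 = (cos (θ p) • e₁ p + sin (θ p) • e₂ p,
      sin (θ p) • e₁ p - cos (θ p) • e₂ p) := by
    have : d2 = (1 / 2 : ℝ) • (d1 + d2) - (1 / 2 : ℝ) • (d1 - d2) := by module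
    rw [this, map_sub, ha, hb]
    refine Prod.ext ?_ ?_ <;> simp
  have hX : inner ℝ (fderiv ℝ φ p d1).1 (fderiv ℝ φ p d2).1 = Real.cos (2 * θ p) := by
    rw [h1, h2, Real.cos_two_mul']
    simp only [inner_add_right, inner_sub_left, real_inner_smul_left, real_inner_smul_right,
      e11, e12, e21, e22]
    ring
  have hY : inner ℝ (fderiv ℝ φ p d1).2 (fderiv ℝ φ p d2).1 = Real.sin (2 * θ p) := by
    rw [h1, h2, Real.sin_two_mul]
    simp only [inner_add_right, inner_add_left, real_inner_smul_left, real_inner_smul_right,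
      e11, e12, e21, e22]
    ring
  rw [Bilegendrian.angleInvariant, hX, hY, Complex.exp_mul_I, Complex.ofReal_cos,
    Complex.ofReal_sin]

theorem IsAngleFunction.postcomp {φ : ℝ × ℝ → ℍ × ℍ} {θ : ℝ × ℝ → ℝ}
    (h : IsAngleFunction φ θ) (hφ : Differentiable ℝ φ) {R : ℍ ≃ₗᵢ[ℝ] ℍ} (hR : R ∈ SOH) :
    IsAngleFunction (postcomp R φ) θ := by
  obtain ⟨hθ, e₁, e₂, he₁, he₂, h⟩ := h
  refine ⟨hθ, fun p => R (e₁ p), fun p => R (e₂ p),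
    R.toContinuousLinearEquiv.contDiff.comp he₁, R.toContinuousLinearEquiv.contDiff.comp he₂,
    fun p => ?_⟩
  obtain ⟨ho, hv, ha, hb⟩ := h p
  refine ⟨?_, ?_, ?_, ?_⟩
  · have := ho.comp_linearIsometry R.toLinearIsometry
    convert this using 1
    funext i
    fin_cases i <;> rfl
  · rw [Bilegendrian.postcomp, vol_of_mem_SOH hR]
    exact hv
  · rw [fderiv_postcomp R (hφ p), ha]
    simp
  · rw [fderiv_postcomp R (hφ p), hb]
    simp

/-! ### The factorization of bilegendrian immersions -/

theorem hasDerivAt_line₁ {F : Type*} [NormedAddCommGroup F] [NormedSpace ℝ F]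
    {f : ℝ × ℝ → F} {x y : ℝ} (hf : DifferentiableAt ℝ f (x, y)) :
    HasDerivAt (fun t => f (t, y)) (fderiv ℝ f (x, y) d1) x :=
  HasFDerivAt.comp_hasDerivAt (f := fun t : ℝ => (t, y)) x hf.hasFDerivAt
    ((hasDerivAt_id x).prodMk (hasDerivAt_const x y))

theorem hasDerivAt_line₂ {F : Type*} [NormedAddCommGroup F] [NormedSpace ℝ F]
    {f : ℝ × ℝ → F} {x y : ℝ} (hf : DifferentiableAt ℝ f (x, y)) :
    HasDerivAt (fun t => f (x, t)) (fderiv ℝ f (x, y) d2) y :=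
  HasFDerivAt.comp_hasDerivAt (f := fun t : ℝ => (x, t)) y hf.hasFDerivAt
    ((hasDerivAt_const y x).prodMk (hasDerivAt_id y))

theorem _root_.HasDerivAt.quaternion_star {γ : ℝ → ℍ} {γ' : ℍ} {x : ℝ} (h : HasDerivAt γ γ' x) :
    HasDerivAt (fun y => star (γ y)) (star γ') x :=
  starCLM.hasFDerivAt.comp_hasDerivAt x h

theorem eq_of_hasDerivAt_zero {F : Type*} [NormedAddCommGroup F] [NormedSpace ℝ F]
    {f : ℝ → F} (h : ∀ x, HasDerivAt f 0 x) (x y : ℝ) : f x = f y :=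
  is_const_of_deriv_eq_zero (fun x => (h x).differentiableAt) (fun x => (h x).deriv) x y

theorem hasDerivAt_clm_apply {E F : Type*} [NormedAddCommGroup E] [NormedSpace ℝ E]
    [NormedAddCommGroup F] [NormedSpace ℝ F] {A : ℝ → E →L[ℝ] F} {A' : E →L[ℝ] F} {x : ℝ}
    (h : HasDerivAt A A' x) (v : E) : HasDerivAt (fun t => A t v) (A' v) x :=
  (ContinuousLinearMap.apply ℝ F v).hasFDerivAt.comp_hasDerivAt x h

theorem exists_hasDerivAt_mixed {F : Type*} [NormedAddCommGroup F] [NormedSpace ℝ F]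
    {f : ℝ × ℝ → F} (hf : ContDiff ℝ ∞ f) (x y : ℝ) :
    ∃ D : F, HasDerivAt (fun t => fderiv ℝ f (x, t) d1) D y ∧
      HasDerivAt (fun t => fderiv ℝ f (t, y) d2) D x := by
  have hd : Differentiable ℝ f := hf.differentiable (by simp)
  have hD := (contDiff_infty_iff_fderiv.1 hf).2.differentiable (by simp) (x, y)
  have h1 : HasDerivAt (fun t => fderiv ℝ f (x, t)) (fderiv ℝ (fderiv ℝ f) (x, y) d2) y :=
    hasDerivAt_line₂ hD
  have h2 : HasDerivAt (fun t => fderiv ℝ f (t, y)) (fderiv ℝ (fderiv ℝ f) (x, y) d1) x :=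
    hasDerivAt_line₁ hD
  have hs : fderiv ℝ (fderiv ℝ f) (x, y) d1 d2 = fderiv ℝ (fderiv ℝ f) (x, y) d2 d1 :=
    second_derivative_symmetric (fun p => (hd p).hasFDerivAt) hD.hasFDerivAt d1 d2
  exact ⟨fderiv ℝ (fderiv ℝ f) (x, y) d2 d1, hasDerivAt_clm_apply h1 d1,
    (hasDerivAt_clm_apply h2 d2).congr_deriv hs⟩

theorem IsNormalized.fderiv_d1_snd {φ : ℝ × ℝ → ℍ × ℍ} (hn : IsNormalized φ) (p : ℝ × ℝ) :
    (fderiv ℝ φ p d1).2 = (φ p).2 * star (φ p).1 * (fderiv ℝ φ p d1).1 :=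
  (congrArg Prod.snd (hn.eigen₁ p)).symm

theorem IsNormalized.fderiv_d2_snd {φ : ℝ × ℝ → ℍ × ℍ} (hn : IsNormalized φ) (p : ℝ × ℝ) :
    (fderiv ℝ φ p d2).2 = -((φ p).2 * star (φ p).1 * (fderiv ℝ φ p d2).1) := by
  have : (φ p).2 * star (φ p).1 * (fderiv ℝ φ p d2).1 = -(fderiv ℝ φ p d2).2 :=
    congrArg Prod.snd (hn.eigen₂ p)
  rw [this, neg_neg]

namespace IsBilegendrianImmersion

variable {φ : ℝ × ℝ → ℍ × ℍ} (hb : IsBilegendrianImmersion φ) (hn : IsNormalized φ)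
include hb

theorem differentiable : Differentiable ℝ φ := hb.smooth.differentiable (by simp)

theorem norm_fst (p : ℝ × ℝ) : ‖(φ p).1‖ = 1 := by
  have := (hb.mem_US3 p).1
  rw [real_inner_self_eq_norm_mul_norm] at this
  nlinarith [norm_nonneg (φ p).1]

theorem norm_snd (p : ℝ × ℝ) : ‖(φ p).2‖ = 1 := by
  have := (hb.mem_US3 p).2.1
  rw [real_inner_self_eq_norm_mul_norm] at this
  nlinarith [norm_nonneg (φ p).2]

theorem star_fst_mul_fst (p : ℝ × ℝ) : star (φ p).1 * (φ p).1 = 1 :=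
  star_mul_self_eq_one (hb.norm_fst p)

theorem fst_mul_star_fst (p : ℝ × ℝ) : (φ p).1 * star (φ p).1 = 1 :=
  mul_star_self_eq_one (hb.norm_fst p)

theorem star_fderiv_mul (p v : ℝ × ℝ) :
    star (fderiv ℝ φ p v).1 * (φ p).1 = -(star (φ p).1 * (fderiv ℝ φ p v).1) := by
  have := star_mul_add_star_mul (fderiv ℝ φ p v).1 (φ p).1
  rw [(hb.integral p v).1] at this
  simpa using eq_neg_of_add_eq_zero_left (this.trans (by simp))

theorem star_fderiv_mul_snd (p v : ℝ × ℝ) :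
    star (fderiv ℝ φ p v).1 * (φ p).2 = -(star (φ p).2 * (fderiv ℝ φ p v).1) := by
  have := star_mul_add_star_mul (fderiv ℝ φ p v).1 (φ p).2
  rw [(hb.integral p v).2.1] at this
  simpa using eq_neg_of_add_eq_zero_left (this.trans (by simp))

theorem snd_mul_star_fst (p : ℝ × ℝ) :
    (φ p).2 * star (φ p).1 = -((φ p).1 * star (φ p).2) := by
  have := mul_star_add_mul_star (φ p).2 (φ p).1
  rw [real_inner_comm, (hb.mem_US3 p).2.2] at this
  simpa using eq_neg_of_add_eq_zero_left (this.trans (by simp))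

theorem hasDerivAt_line₁ (x y : ℝ) :
    HasDerivAt (fun t => (φ (t, y)).1) (fderiv ℝ φ (x, y) d1).1 x ∧
      HasDerivAt (fun t => (φ (t, y)).2) (fderiv ℝ φ (x, y) d1).2 x :=
  ⟨(Bilegendrian.hasDerivAt_line₁ (hb.differentiable _)).fst,
    (Bilegendrian.hasDerivAt_line₁ (hb.differentiable _)).snd⟩

theorem hasDerivAt_line₂ (x y : ℝ) :
    HasDerivAt (fun t => (φ (x, t)).1) (fderiv ℝ φ (x, y) d2).1 y ∧
      HasDerivAt (fun t => (φ (x, t)).2) (fderiv ℝ φ (x, y) d2).2 y :=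
  ⟨(Bilegendrian.hasDerivAt_line₂ (hb.differentiable _)).fst,
    (Bilegendrian.hasDerivAt_line₂ (hb.differentiable _)).snd⟩

include hn

/-- With ξ = ∂₁X orthogonal to X, one has Yξ̄ = Y(ξ̄X)X̄ = -YX̄ξX̄, which cancels ∂₁Y X̄. Along x₂
the sign of ∂₂Y is opposite and the two terms add up instead. -/
theorem hasDerivAt_normal₁ (x y : ℝ) :
    HasDerivAt (fun t => (φ (t, y)).2 * star (φ (t, y)).1) 0 x := by
  refine ((hb.hasDerivAt_line₁ x y).2.mul
    (hb.hasDerivAt_line₁ x y).1.quaternion_star).congr_deriv ?_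
  rw [hn.fderiv_d1_snd]
  set X := (φ (x, y)).1
  set Y := (φ (x, y)).2
  set ξ := (fderiv ℝ φ (x, y) d1).1
  have h : star ξ * X = -(star X * ξ) := hb.star_fderiv_mul _ _
  have h1 : X * star X = 1 := hb.fst_mul_star_fst _
  calc Y * star X * ξ * star X + Y * star ξ
      = Y * star X * ξ * star X + Y * (star ξ * X) * star X := by
        rw [mul_assoc Y (star ξ * X), mul_assoc (star ξ), h1, mul_one]
    _ = 0 := by rw [h]; noncomm_ring

theorem hasDerivAt_normal₂ (x y : ℝ) :
    HasDerivAt (fun t => (φ (x, t)).2 * star (φ (x, t)).1)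
      (-(2 • ((φ (x, y)).2 * star (φ (x, y)).1 * (fderiv ℝ φ (x, y) d2).1 *
        star (φ (x, y)).1))) y := by
  refine ((hb.hasDerivAt_line₂ x y).2.mul
    (hb.hasDerivAt_line₂ x y).1.quaternion_star).congr_deriv ?_
  rw [hn.fderiv_d2_snd]
  set X := (φ (x, y)).1
  set Y := (φ (x, y)).2
  set ξ := (fderiv ℝ φ (x, y) d2).1
  have h : star ξ * X = -(star X * ξ) := hb.star_fderiv_mul _ _
  have h1 : X * star X = 1 := hb.fst_mul_star_fst _
  calc -(Y * star X * ξ) * star X + Y * star ξ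
      = -(Y * star X * ξ) * star X + Y * (star ξ * X) * star X := by
        rw [mul_assoc Y (star ξ * X), mul_assoc (star ξ), h1, mul_one]
    _ = _ := by rw [h]; noncomm_ring

/-- Orthogonality of ξ = ∂₂X to Y gives ξ̄Y = -Ȳξ, and orthogonality of X and Y gives X̄ ∂₂Y = X̄XȲξ
= Ȳξ. -/
theorem hasDerivAt_conormal₂ (x y : ℝ) :
    HasDerivAt (fun t => star (φ (x, t)).1 * (φ (x, t)).2) 0 y := by
  refine ((hb.hasDerivAt_line₂ x y).1.quaternion_star.mul
    (hb.hasDerivAt_line₂ x y).2).congr_deriv ?_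
  rw [hn.fderiv_d2_snd, hb.star_fderiv_mul_snd, hb.snd_mul_star_fst]
  set X := (φ (x, y)).1
  set Y := (φ (x, y)).2
  set ξ := (fderiv ℝ φ (x, y) d2).1
  have h1 : star X * X = 1 := hb.star_fst_mul_fst _
  calc -(star Y * ξ) + star X * -(-(X * star Y) * ξ)
      = -(star Y * ξ) + (star X * X) * star Y * ξ := by noncomm_ring
    _ = 0 := by rw [h1]; noncomm_ring

theorem normal_eq (x y : ℝ) :
    (φ (x, y)).2 * star (φ (x, y)).1 = (φ (0, y)).2 * star (φ (0, y)).1 :=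
  eq_of_hasDerivAt_zero (fun x => hb.hasDerivAt_normal₁ hn x y) x 0

theorem conormal_eq (x y : ℝ) :
    star (φ (x, y)).1 * (φ (x, y)).2 = star (φ (x, 0)).1 * (φ (x, 0)).2 :=
  eq_of_hasDerivAt_zero (fun y => hb.hasDerivAt_conormal₂ hn x y) y 0

/-- The mixed second derivative of `X` is `∂₂X X⁻¹ ∂₁X`. -/
theorem hasDerivAt_fderiv_d1 (x y : ℝ) :
    HasDerivAt (fun t => (fderiv ℝ φ (x, t) d1).1)
      ((fderiv ℝ φ (x, y) d2).1 * star (φ (x, y)).1 * (fderiv ℝ φ (x, y) d1).1) y := by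
  obtain ⟨D, h12, h21⟩ := exists_hasDerivAt_mixed hb.smooth x y
  have h12f : HasDerivAt (fun t => (fderiv ℝ φ (x, t) d1).1) D.1 y := h12.fst
  have h12s : HasDerivAt (fun t => (fderiv ℝ φ (x, t) d1).2) D.2 y := h12.snd
  have h21f : HasDerivAt (fun t => (fderiv ℝ φ (t, y) d2).1) D.1 x := h21.fst
  have h21s : HasDerivAt (fun t => (fderiv ℝ φ (t, y) d2).2) D.2 x := h21.snd
  refine h12f.congr_deriv ?_
  set X := (φ (x, y)).1 with hX
  set Y := (φ (x, y)).2 with hY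
  set ξ₁ := (fderiv ℝ φ (x, y) d1).1 with hξ₁
  set ξ₂ := (fderiv ℝ φ (x, y) d2).1 with hξ₂
  -- The mixed derivative of Y is computed in both orders: along x₂ from ∂₁Y = A ∂₁X, where A = YX̄
  -- varies, and along x₁ from ∂₂Y = -A ∂₂X, where A is constant. Equating the two leaves twice A
  -- times the mixed derivative of X, and A is invertible.
  have e1 : D.2 = -(2 • (Y * star X * ξ₂ * star X)) * ξ₁ +
      Y * star X * D.1 := by
    have := (hb.hasDerivAt_normal₂ hn x y).mul h12f
    refine h12s.unique ?_
    rw [show (fun t => (fderiv ℝ φ (x, t) d1).2) = _ from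
      funext fun t => hn.fderiv_d1_snd (x, t)]
    exact this
  have e2 : D.2 = -(Y * star X * D.1) := by
    have := ((hb.hasDerivAt_normal₁ hn x y).mul h21f).neg
    rw [zero_mul, zero_add] at this
    refine h21s.unique ?_
    rw [show (fun t => (fderiv ℝ φ (t, y) d2).2) = _ from
      funext fun t => hn.fderiv_d2_snd (t, y)]
    exact this
  have e3 : (2 : ℝ) • (Y * star X * D.1) = (2 : ℝ) • (Y * star X * (ξ₂ * star X * ξ₁)) := by
    rw [e1] at e2
    have h := eq_neg_iff_add_eq_zero.1 e2
    rw [two_smul, two_smul, ← sub_eq_zero, ← h]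
    noncomm_ring
  have e4 := smul_right_injective ℍ (two_ne_zero : (2 : ℝ) ≠ 0) e3
  have hne : Y * star X ≠ 0 := by
    rw [← norm_ne_zero_iff, norm_mul, Quaternion.norm_star, hX, hY, hb.norm_fst, hb.norm_snd]
    norm_num
  exact mul_left_cancel₀ hne e4

theorem maurerCartan_eq (x y : ℝ) :
    star (φ (x, y)).1 * (fderiv ℝ φ (x, y) d1).1 =
      star (φ (x, 0)).1 * (fderiv ℝ φ (x, 0) d1).1 := by
  refine eq_of_hasDerivAt_zero (f := fun y => star (φ (x, y)).1 * (fderiv ℝ φ (x, y) d1).1)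
    (fun y => ?_) y 0
  refine ((hb.hasDerivAt_line₂ x y).1.quaternion_star.mul
    (hb.hasDerivAt_fderiv_d1 hn x y)).congr_deriv ?_
  have h := hb.star_fderiv_mul (x, y) d2
  have h1 := hb.fst_mul_star_fst (x, y)
  set X := (φ (x, y)).1
  set ξ₁ := (fderiv ℝ φ (x, y) d1).1
  set ξ₂ := (fderiv ℝ φ (x, y) d2).1
  calc star ξ₂ * ξ₁ + star X * (ξ₂ * star X * ξ₁)
      = (star ξ₂ * (X * star X) + star X * ξ₂ * star X) * ξ₁ := by
        rw [h1]; noncomm_ring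
    _ = 0 := by
        rw [← mul_assoc, h]; noncomm_ring

theorem fst_eq (x y : ℝ) :
    (φ (x, y)).1 = (φ (0, y)).1 * star (φ (0, 0)).1 * (φ (x, 0)).1 := by
  have key : (φ (x, y)).1 * star (φ (x, 0)).1 = (φ (0, y)).1 * star (φ (0, 0)).1 := by
    refine eq_of_hasDerivAt_zero (f := fun x => (φ (x, y)).1 * star (φ (x, 0)).1)
      (fun x => ?_) x 0
    refine ((hb.hasDerivAt_line₁ x y).1.mul
      (hb.hasDerivAt_line₁ x 0).1.quaternion_star).congr_deriv ?_
    have h := hb.star_fderiv_mul (x, 0) d1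
    have h1 := hb.fst_mul_star_fst (x, 0)
    have h2 := hb.fst_mul_star_fst (x, y)
    have h3 := hb.maurerCartan_eq hn x y
    set X := (φ (x, y)).1
    set X' := (φ (x, 0)).1
    set ξ := (fderiv ℝ φ (x, y) d1).1
    set ξ' := (fderiv ℝ φ (x, 0) d1).1
    calc ξ * star X' + X * star ξ'
        = (X * star X) * ξ * star X' + X * star ξ' * (X' * star X') := by
          rw [h1, h2, one_mul, mul_one]
      _ = X * (star X * ξ) * star X' + X * (star ξ' * X') * star X' := by noncomm_ring
      _ = 0 := by rw [h, h3]; noncomm_ring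
  rw [← key, mul_assoc, hb.star_fst_mul_fst, mul_one]

/-- Write Y = (YX̄)X, with YX̄ independent of x₁; on the axis x₁ = 0 write Y = X(X̄Y), with X̄Y
independent of x₂. -/
theorem snd_eq (x y : ℝ) :
    (φ (x, y)).2 = (φ (0, y)).1 * star (φ (0, 0)).1 * (φ (0, 0)).2 * star (φ (0, 0)).1 *
      (φ (x, 0)).1 := by
  have h1 : (φ (x, y)).2 = (φ (x, y)).2 * star (φ (x, y)).1 * (φ (x, y)).1 := by
    rw [mul_assoc, hb.star_fst_mul_fst, mul_one]
  have h2 : (φ (0, y)).2 = (φ (0, y)).1 * (star (φ (0, y)).1 * (φ (0, y)).2) := by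
    rw [← mul_assoc, hb.fst_mul_star_fst, one_mul]
  rw [h1, hb.normal_eq hn, hb.fst_eq hn x y]
  calc (φ (0, y)).2 * star (φ (0, y)).1 * ((φ (0, y)).1 * star (φ (0, 0)).1 * (φ (x, 0)).1)
      = (φ (0, y)).2 * (star (φ (0, y)).1 * (φ (0, y)).1) * star (φ (0, 0)).1 * (φ (x, 0)).1 := by
        noncomm_ring
    _ = (φ (0, y)).2 * star (φ (0, 0)).1 * (φ (x, 0)).1 := by
        rw [hb.star_fst_mul_fst, mul_one]
    _ = _ := by
        rw [h2, hb.conormal_eq hn 0 y]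
        noncomm_ring

end IsBilegendrianImmersion

/-! ### The normal form of bilegendrian immersions -/

theorem star_mul_cancel {a : ℍ} (ha : ‖a‖ = 1) (b : ℍ) : star a * (a * b) = b := by
  rw [← mul_assoc, star_mul_self_eq_one ha, one_mul]

theorem mul_star_cancel {a : ℍ} (ha : ‖a‖ = 1) (b : ℍ) : a * (star a * b) = b := by
  rw [← mul_assoc, mul_star_self_eq_one ha, one_mul]

theorem re_mul_comm (a b : ℍ) : (a * b).re = (b * a).re := by
  simp
  ring

theorem re_conj {c : ℍ} (hc : ‖c‖ = 1) (q : ℍ) : (c * q * star c).re = q.re := by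
  rw [re_mul_comm, star_mul_cancel hc]

theorem inner_conj {c : ℍ} (hc : ‖c‖ = 1) (p q : ℍ) :
    inner ℝ (c * p * star c) (c * q * star c) = inner ℝ p q := by
  rw [inner_mul_right_of_norm_eq_one (by rw [Quaternion.norm_star, hc]),
    inner_mul_left_of_norm_eq_one hc]

theorem inner_qk (a : ℍ) : inner ℝ a qk = a.imK := by
  rw [inner_quaternion]
  simp

/-- The component of a quaternion in the plane spanned by `i` and `j`. -/
def ijPart (a : ℍ) : ℂ := (inner ℝ qi a : ℝ) + (inner ℝ qj a : ℝ) * Complex.I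

theorem ij_ijPart {a : ℍ} (h0 : a.re = 0) (h1 : a.imK = 0) : ij (ijPart a) = a := by
  ext <;> simp [ijPart, inner_quaternion, h0, h1]

theorem ijPart_qi : ijPart qi = 1 := by
  have h : inner ℝ qi qi = (1 : ℝ) := by simp only [inner_quaternion]; simp
  have h' : inner ℝ qj qi = (0 : ℝ) := by simp [inner_quaternion]
  simp [ijPart, h, h', -inner_self_eq_norm_sq_to_K]

theorem contDiff_ijPart : ContDiff ℝ ∞ ijPart :=
  (Complex.ofRealCLM.contDiff.comp (contDiff_const.inner ℝ contDiff_id)).add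
    ((Complex.ofRealCLM.contDiff.comp (contDiff_const.inner ℝ contDiff_id)).mul contDiff_const)

theorem IsNormalized.norm_fderiv_d1 {φ : ℝ × ℝ → ℍ × ℍ} (hb : IsBilegendrianImmersion φ)
    (hn : IsNormalized φ) (p : ℝ × ℝ) : ‖(fderiv ℝ φ p d1).1‖ = 1 := by
  have h := hn.metric p d1 d1
  have e : (2 : ℝ) * (d1.1 * d1.1 + d1.2 * d1.2) = 2 := by simp [d1]
  rw [e] at h
  rw [gHat, hn.fderiv_d1_snd, inner_mul_left_of_norm_eq_one, real_inner_self_eq_norm_sq] at h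
  · nlinarith [norm_nonneg (fderiv ℝ φ p d1).1]
  · rw [norm_mul, Quaternion.norm_star, hb.norm_fst, hb.norm_snd, one_mul]

theorem IsNormalized.norm_fderiv_d2 {φ : ℝ × ℝ → ℍ × ℍ} (hb : IsBilegendrianImmersion φ)
    (hn : IsNormalized φ) (p : ℝ × ℝ) : ‖(fderiv ℝ φ p d2).1‖ = 1 := by
  have h := hn.metric p d2 d2
  have e : (2 : ℝ) * (d2.1 * d2.1 + d2.2 * d2.2) = 2 := by simp [d2]
  rw [e] at h
  rw [gHat, hn.fderiv_d2_snd, inner_neg_neg, inner_mul_left_of_norm_eq_one,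
    real_inner_self_eq_norm_sq] at h
  · nlinarith [norm_nonneg (fderiv ℝ φ p d2).1]
  · rw [norm_mul, Quaternion.norm_star, hb.norm_fst, hb.norm_snd, one_mul]

theorem contDiff_fderiv_apply {E F : Type*} [NormedAddCommGroup E] [NormedSpace ℝ E]
    [NormedAddCommGroup F] [NormedSpace ℝ F] {f : E → F} (hf : ContDiff ℝ ∞ f) (v : E) :
    ContDiff ℝ ∞ (fun p => fderiv ℝ f p v) :=
  (contDiff_infty_iff_fderiv.1 hf).2.clm_apply contDiff_const

/-- Right multiplication by X̄₀ moves X(0, 0) to 1; conjugation by c then sends the normal Y₀X̄₀ to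
k and the velocity ∂₁X X̄₀ to i. The curves are the images of the restrictions of X to the two axes.
-/
theorem exists_isFrame {φ : ℝ × ℝ → ℍ × ℍ} (hb : IsBilegendrianImmersion φ)
    (hn : IsNormalized φ) :
    ∃ R ∈ SOH, ∃ ζ₁ ζ₂ : ℝ → ℂ, ∃ γ₁ γ₂ : ℝ → ℍ, IsFrame ζ₁ ζ₂ γ₁ γ₂ ∧ ContDiff ℝ ∞ ζ₁ ∧
      ContDiff ℝ ∞ ζ₂ ∧ ζ₁ 0 = 1 ∧ postcomp R φ = prodMap γ₁ γ₂ := by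
  have hX0 : ‖(φ (0, 0)).1‖ = 1 := hb.norm_fst _
  have hY0 : ‖(φ (0, 0)).2‖ = 1 := hb.norm_snd _
  set X₀ := (φ (0, 0)).1 with hX₀
  set Y₀ := (φ (0, 0)).2 with hY₀
  have hsX0 : ‖star X₀‖ = 1 := by rw [Quaternion.norm_star, hX0]
  obtain ⟨c, hc, hck, hci⟩ := exists_conj_eq_qk_qi (n := Y₀ * star X₀)
    (v := (fderiv ℝ φ (0, 0) d1).1 * star X₀)
    (by rw [norm_mul, hY0, hsX0, one_mul])
    (by rw [← Quaternion.inner_def, real_inner_comm]; exact (hb.mem_US3 _).2.2)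
    (by rw [norm_mul, hn.norm_fderiv_d1 hb, hsX0, one_mul])
    (by rw [← Quaternion.inner_def]; exact (hb.integral _ d1).1)
    (by rw [inner_mul_right_of_norm_eq_one hsX0]; exact (hb.integral _ d1).2.1)
  have hsc : ‖star c‖ = 1 := by rw [Quaternion.norm_star, hc]
  have hd : ‖star X₀ * star c‖ = 1 := by rw [norm_mul, hsX0, hsc, one_mul]
  -- These are γ₁'γ₁⁻¹ and γ₂⁻¹γ₂' for the curves γ₁, γ₂ given below.
  set w₁ : ℝ → ℍ := fun x => c * ((fderiv ℝ φ (x, 0) d1).1 * star (φ (x, 0)).1) * star c with hw₁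
  set w₂ : ℝ → ℍ := fun y =>
    c * (X₀ * (star (φ (0, y)).1 * (fderiv ℝ φ (0, y) d2).1) * star X₀) * star c with hw₂
  have hij₁ : ∀ x, ij (ijPart (w₁ x)) = w₁ x := by
    intro x
    apply ij_ijPart
    · rw [hw₁, re_conj hc, ← Quaternion.inner_def]
      exact (hb.integral _ d1).1
    -- The normal YX̄ is constant along the first axis, so orthogonality of ∂₁X to Y becomes
    -- orthogonality of w₁ to k all along it. The second axis uses the constancy of X̄Y in the same
    -- way.
    · have e : Y₀ * star X₀ = (φ (x, 0)).2 * star (φ (x, 0)).1 := (hb.normal_eq hn x 0).symm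
      rw [← inner_qk, ← hck, hw₁, inner_conj hc, e,
        inner_mul_right_of_norm_eq_one (by rw [Quaternion.norm_star, hb.norm_fst])]
      exact (hb.integral _ d1).2.1
  have hij₂ : ∀ y, ij (ijPart (w₂ y)) = w₂ y := by
    intro y
    apply ij_ijPart
    · rw [hw₂, re_conj hc, re_conj hX0, re_mul_comm, ← Quaternion.inner_def]
      exact (hb.integral _ d2).1
    · have e : Y₀ * star X₀ = X₀ * (star (φ (0, y)).1 * (φ (0, y)).2) * star X₀ := by
        rw [hb.conormal_eq hn 0 y, mul_star_cancel hX0]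
      rw [← inner_qk, ← hck, hw₂, inner_conj hc, e, inner_conj hX0,
        inner_mul_left_of_norm_eq_one (by rw [Quaternion.norm_star, hb.norm_fst])]
      exact (hb.integral _ d2).2.1
  have hsm := hb.smooth
  have hsmX₁ : ContDiff ℝ ∞ (fun x : ℝ => (φ (x, 0)).1) :=
    (hsm.comp (contDiff_id.prodMk contDiff_const)).fst
  have hsmX₂ : ContDiff ℝ ∞ (fun y : ℝ => (φ (0, y)).1) :=
    (hsm.comp (contDiff_const.prodMk contDiff_id)).fst
  have hsmξ₁ : ContDiff ℝ ∞ (fun x : ℝ => (fderiv ℝ φ (x, 0) d1).1) :=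
    ((contDiff_fderiv_apply hsm d1).comp (contDiff_id.prodMk contDiff_const)).fst
  have hsmξ₂ : ContDiff ℝ ∞ (fun y : ℝ => (fderiv ℝ φ (0, y) d2).1) :=
    ((contDiff_fderiv_apply hsm d2).comp (contDiff_const.prodMk contDiff_id)).fst
  have hstar : ContDiff ℝ ∞ (fun q : ℍ => star q) := starCLM.contDiff
  refine ⟨sandwich c (star X₀ * star c) hc hd, sandwich_mem_SOH hc hd,
    fun x => ijPart (w₁ x), fun y => ijPart (w₂ y),
    fun x => c * (φ (x, 0)).1 * (star X₀ * star c), fun y => c * (φ (0, y)).1 * (star X₀ * star c),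
    ⟨?_, ?_, ?_, ?_, ?_, ?_, ?_, ?_, ?_, ?_⟩, ?_, ?_, ?_, ?_⟩
  · exact (contDiff_const.mul hsmX₁).mul contDiff_const
  · exact (contDiff_const.mul hsmX₂).mul contDiff_const
  · intro x
    simp only [norm_mul, hb.norm_fst, hc, hsc, hsX0, one_mul]
  · intro x
    simp only [norm_mul, hb.norm_fst, hc, hsc, hsX0, one_mul]
  · simp only [← hX₀, mul_assoc, mul_star_cancel hX0, mul_star_self_eq_one hc]
  · simp only [← hX₀, mul_assoc, mul_star_cancel hX0, mul_star_self_eq_one hc]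
  · intro x
    rw [← norm_ij, hij₁]
    simp only [hw₁, norm_mul, hc, hsc, hn.norm_fderiv_d1 hb, Quaternion.norm_star, hb.norm_fst,
      one_mul]
  · intro x
    rw [← norm_ij, hij₂]
    simp only [hw₂, norm_mul, hc, hsc, hn.norm_fderiv_d2 hb, Quaternion.norm_star, hb.norm_fst,
      hX0, one_mul]
  · intro x
    refine (((hb.hasDerivAt_line₁ x 0).1.const_mul c).mul_const _).congr_deriv ?_
    rw [hij₁, hw₁]
    simp only [mul_assoc, star_mul_cancel hc, star_mul_cancel (hb.norm_fst _)]
  · intro y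
    refine (((hb.hasDerivAt_line₂ 0 y).1.const_mul c).mul_const _).congr_deriv ?_
    rw [hij₂, hw₂]
    simp only [mul_assoc, star_mul_cancel hc, star_mul_cancel hX0, mul_star_cancel (hb.norm_fst _)]
  · exact contDiff_ijPart.comp ((contDiff_const.mul (hsmξ₁.mul (hstar.comp hsmX₁))).mul
      contDiff_const)
  · exact contDiff_ijPart.comp ((contDiff_const.mul ((contDiff_const.mul
      ((hstar.comp hsmX₂).mul hsmξ₂)).mul contDiff_const)).mul contDiff_const)
  · change ijPart (c * ((fderiv ℝ φ (0, 0) d1).1 * star X₀) * star c) = 1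
    rw [hci, ijPart_qi]
  · funext p
    obtain ⟨x, y⟩ := p
    refine Prod.ext ?_ ?_
    · simp only [postcomp, prodMap, sandwich_apply]
      rw [hb.fst_eq hn x y]
      simp only [← hX₀, mul_assoc, star_mul_cancel hc]
    · simp only [postcomp, prodMap, sandwich_apply]
      rw [hb.snd_eq hn x y, ← hck]
      simp only [← hX₀, ← hY₀, mul_assoc, star_mul_cancel hc]

/-! ### Angular lifts of curves in the unit circle -/

theorem primitive_hasDerivAt {f : ℝ → ℝ} (hf : Continuous f) (x : ℝ) :
    HasDerivAt (fun x => ∫ y in (0 : ℝ)..x, f y) (f x) x :=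
  intervalIntegral.integral_hasDerivAt_right (hf.intervalIntegrable _ _)
    (hf.stronglyMeasurableAtFilter _ _) hf.continuousAt

/-- Since |ζ| = 1, the logarithmic derivative ζ'ζ̄ is purely imaginary, equal to if; then ζ e^{-i∫f}
has zero derivative. -/
theorem exists_lift {ζ : ℝ → ℂ} (hζ : ContDiff ℝ ∞ ζ) (h1 : ∀ x, ‖ζ x‖ = 1) :
    ∃ f : ℝ → ℝ, ContDiff ℝ ∞ f ∧
      ∀ x, ζ x = ζ 0 * Complex.exp ((∫ y in (0 : ℝ)..x, f y : ℝ) * Complex.I) := by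
  have hd : ∀ x, HasDerivAt ζ (deriv ζ x) x := fun x =>
    (hζ.differentiable (by simp) x).hasDerivAt
  have hstar : ContDiff ℝ ∞ (fun z : ℂ => star z) := Complex.conjCLE.contDiff
  set f : ℝ → ℝ := fun x => (deriv ζ x * star (ζ x)).im
  have hf : ContDiff ℝ ∞ f := Complex.imCLM.contDiff.comp
    ((contDiff_infty_iff_deriv.1 hζ).2.mul (hstar.comp hζ))
  have hunit : ∀ x, ζ x * star (ζ x) = 1 := fun x => by
    have := Complex.mul_conj (ζ x)
    rw [Complex.normSq_eq_norm_sq, h1] at this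
    simpa using this
  have hre : ∀ x, (deriv ζ x * star (ζ x)).re = 0 := fun x => by
    have hs : HasDerivAt (fun x => star (ζ x)) (star (deriv ζ x)) x := (hd x).star
    have h := (hd x).mul hs
    have h' : HasDerivAt (ζ * fun x => star (ζ x)) 0 x := by
      rw [show (ζ * fun x => star (ζ x)) = fun _ => 1 from funext hunit]
      exact hasDerivAt_const x 1
    have := congrArg Complex.re (h.unique h')
    simp at this ⊢
    linarith
  have hd' : ∀ x, deriv ζ x = Complex.I * f x * ζ x := fun x => by
    have : deriv ζ x * star (ζ x) = Complex.I * f x := by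
      apply Complex.ext
      · rw [hre]; simp
      · simp [f]
    calc deriv ζ x = deriv ζ x * (ζ x * star (ζ x)) := by rw [hunit, mul_one]
      _ = (deriv ζ x * star (ζ x)) * ζ x := by ring
      _ = _ := by rw [this]
  refine ⟨f, hf, fun x => ?_⟩
  have hF : ∀ x, HasDerivAt (fun x : ℝ => ((∫ y in (0 : ℝ)..x, f y : ℝ) : ℂ)) (f x : ℂ) x :=
    fun x => (primitive_hasDerivAt hf.continuous x).ofReal_comp
  have key := eq_of_hasDerivAt_zero
    (f := fun x => ζ x * Complex.exp (-((∫ y in (0 : ℝ)..x, f y : ℝ) * Complex.I))) (fun x => by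
      refine ((hd x).mul ((hF x).mul_const Complex.I).neg.cexp).congr_deriv ?_
      rw [hd']
      ring) x 0
  simp only [intervalIntegral.integral_same, Complex.ofReal_zero, zero_mul, neg_zero,
    Complex.exp_zero, mul_one] at key
  rw [← key, mul_assoc, ← Complex.exp_add]
  simp

/-! ### The immersion with given invariants -/

theorem SmoothMap.ext {E F : Type*} [NormedAddCommGroup E] [NormedSpace ℝ E]
    [NormedAddCommGroup F] [NormedSpace ℝ F] {f g : SmoothMap E F} (h : ∀ x, f x = g x) :
    f = g := by
  cases f
  cases g
  congr
  exact funext h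

theorem SmoothFam.prodMk {T : Type*} [TopologicalSpace T] {E F G : Type} [NormedAddCommGroup E]
    [NormedSpace ℝ E] [NormedAddCommGroup F] [NormedSpace ℝ F] [NormedAddCommGroup G]
    [NormedSpace ℝ G] {f : T → E → F} {g : T → E → G} (hf : SmoothFam f) (hg : SmoothFam g) :
    SmoothFam (fun t x => (f t x, g t x)) := by
  have h := (hf.clm_comp (ContinuousLinearMap.inl ℝ F G)).add
    (hg.clm_comp (ContinuousLinearMap.inr ℝ F G))
  simpa using h

/-- The primitive that vanishes at the origin. -/
def primitive (f : SmoothMap ℝ ℝ) (x : ℝ) : ℝ := ∫ y in (0 : ℝ)..x, f y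

theorem hasDerivAt_primitive (f : SmoothMap ℝ ℝ) (x : ℝ) : HasDerivAt (primitive f) (f x) x :=
  primitive_hasDerivAt f.smooth.continuous x

@[simp]
theorem primitive_zero (f : SmoothMap ℝ ℝ) : primitive f 0 = 0 := by simp [primitive]

theorem smoothFam_primitive {T : Type*} [TopologicalSpace T] {f : T → SmoothMap ℝ ℝ}
    (hf : Continuous f) : SmoothFam (fun t => primitive (f t)) :=
  (smoothFam_coe.comp_param hf).primitive

theorem contDiff_primitive (f : SmoothMap ℝ ℝ) : ContDiff ℝ ∞ (primitive f) :=
  (smoothFam_primitive continuous_id).contDiff f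

/-- The direction `γ₁' γ₁⁻¹`, as a complex number. -/
def dir₁ (t : Target) (x : ℝ) : ℂ := Complex.exp ((-(2 * primitive t.2.1 x) : ℝ) * Complex.I)

/-- The direction `γ₂⁻¹ γ₂'`, as a complex number. -/
def dir₂ (t : Target) (y : ℝ) : ℂ :=
  t.1 * Complex.exp ((2 * primitive t.2.2 y : ℝ) * Complex.I)

/-- The curve `γ₁` determined by its direction. -/
def curve₁ (t : Target) : ℝ → ℍ := quatExp fun x => ij (dir₁ t x)

/-- The curve `γ₂` determined by its direction. -/
def curve₂ (t : Target) (y : ℝ) : ℍ := star (quatExp (fun y => -ij (dir₂ t y)) y)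

theorem contDiff_exp_mul_I (a : ℝ) :
    ContDiff ℝ ∞ (fun r : ℝ => Complex.exp ((a * r : ℝ) * Complex.I)) := by
  have h : ContDiff ℝ ∞ (fun r : ℝ => ((a * r : ℝ) : ℂ)) :=
    Complex.ofRealCLM.contDiff.comp (contDiff_const.mul contDiff_id)
  exact (h.mul contDiff_const).cexp

theorem smoothFam_dir₁ : SmoothFam dir₁ := by
  have := (smoothFam_primitive (T := Target)
    (continuous_fst.comp continuous_snd)).comp_left (contDiff_exp_mul_I (-2))
  simp only [neg_mul] at this
  exact this

theorem smoothFam_dir₂ : SmoothFam dir₂ :=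
  (smoothFam_const_right (continuous_subtype_val.comp continuous_fst)).mul
    ((smoothFam_primitive (T := Target)
      (continuous_snd.comp continuous_snd)).comp_left (contDiff_exp_mul_I 2))

theorem smoothFam_neg_ij_dir₂ : SmoothFam (fun t y => -ij (dir₂ t y)) :=
  smoothFam_dir₂.clm_comp (-ij)

theorem smoothFam_curve₁ : SmoothFam curve₁ :=
  (smoothFam_dir₁.clm_comp ij).quatExp fun _ _ => ij_re _

theorem smoothFam_curve₂ : SmoothFam curve₂ :=
  (smoothFam_neg_ij_dir₂.quatExp fun t x => by simp).clm_comp starCLM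

theorem continuous_ij_dir₁ (t : Target) : Continuous fun x => ij (dir₁ t x) :=
  ij.continuous.comp (smoothFam_dir₁.contDiff t).continuous

theorem continuous_neg_ij_dir₂ (t : Target) : Continuous fun x => -ij (dir₂ t x) :=
  (smoothFam_neg_ij_dir₂.contDiff t).continuous

theorem neg_ij_re (z : ℂ) : (-ij z).re = 0 := by simp

theorem isFrame_curve (t : Target) : IsFrame (dir₁ t) (dir₂ t) (curve₁ t) (curve₂ t) where
  smooth₁ := smoothFam_curve₁.contDiff t
  smooth₂ := smoothFam_curve₂.contDiff t
  norm₁ := norm_quatExp (continuous_ij_dir₁ t) fun _ => ij_re _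
  norm₂ y := by
    rw [curve₂, Quaternion.norm_star]
    exact norm_quatExp (continuous_neg_ij_dir₂ t) (fun _ => neg_ij_re _) y
  zero₁ := quatExp_zero (continuous_ij_dir₁ t) fun _ => ij_re _
  zero₂ := by
    rw [curve₂, quatExp_zero (continuous_neg_ij_dir₂ t) fun _ => neg_ij_re _, star_one]
  norm_dir₁ x := Complex.norm_exp_ofReal_mul_I _
  norm_dir₂ x := by
    rw [dir₂, norm_mul, Circle.norm_coe, one_mul, Complex.norm_exp_ofReal_mul_I]
  hasDerivAt₁ := hasDerivAt_quatExp (continuous_ij_dir₁ t) fun _ => ij_re _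
  hasDerivAt₂ y := by
    refine (hasDerivAt_quatExp (continuous_neg_ij_dir₂ t)
      (fun _ => neg_ij_re _) y).quaternion_star.congr_deriv ?_
    rw [star_mul, star_neg, star_ij, neg_neg]
    rfl

/-- The normalized bilegendrian immersion with given invariants. -/
def ofTarget (t : Target) : BHat :=
  ⟨⟨prodMap (curve₁ t) (curve₂ t), (isFrame_curve t).contDiff_prodMap⟩,
    (isFrame_curve t).isBilegendrianImmersion, (isFrame_curve t).isNormalized⟩

theorem coe_ofTarget (t : Target) :
    ((ofTarget t).1 : ℝ × ℝ → ℍ × ℍ) = prodMap (curve₁ t) (curve₂ t) := rfl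

theorem continuous_ofTarget : Continuous ofTarget := by
  have h1 : SmoothFam (fun (t : Target) (p : ℝ × ℝ) => curve₁ t p.1) :=
    smoothFam_curve₁.comp_right contDiff_fst
  have h2 : SmoothFam (fun (t : Target) (p : ℝ × ℝ) => curve₂ t p.2) :=
    smoothFam_curve₂.comp_right contDiff_snd
  have hX : SmoothFam (fun (t : Target) (p : ℝ × ℝ) => curve₂ t p.2 * curve₁ t p.1) := h2.mul h1
  have hY : SmoothFam (fun (t : Target) (p : ℝ × ℝ) => curve₂ t p.2 * qk * curve₁ t p.1) :=
    (h2.mul (smoothFam_const_left contDiff_const)).mul h1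
  exact Continuous.subtype_mk (continuous_smoothMap_iff.2 (hX.prodMk hY)) _

theorem exists_postcomp_eq_ofTarget (φ : BHat) :
    ∃ t, ∃ R ∈ SOH, postcomp R φ.1 = (ofTarget t).1 := by
  obtain ⟨R, hR, ζ₁, ζ₂, γ₁, γ₂, hF, h1, h2, h0, h⟩ := exists_isFrame φ.2.1 φ.2.2
  obtain ⟨f, hf, hζf⟩ := exists_lift h1 hF.norm_dir₁
  obtain ⟨g, hg, hζg⟩ := exists_lift h2 hF.norm_dir₂
  -- The factors ∓1/2 undo those of `dir₁` and `dir₂`, which are such that ζ₂ζ̄₁ has argument 2θ.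
  set t : Target := (⟨ζ₂ 0, mem_sphere_zero_iff_norm.2 (hF.norm_dir₂ 0)⟩,
    ⟨fun x => -(1 / 2) * f x, contDiff_const.mul hf⟩,
    ⟨fun x => 1 / 2 * g x, contDiff_const.mul hg⟩) with ht
  have e1 : ζ₁ = dir₁ t := by
    funext x
    have : -(2 * primitive t.2.1 x) = ∫ y in (0 : ℝ)..x, f y := by
      simp only [primitive, ht]
      rw [intervalIntegral.integral_const_mul]
      ring
    rw [hζf, h0, one_mul, dir₁, this]
  have e2 : ζ₂ = dir₂ t := by
    funext x
    have : 2 * primitive t.2.2 x = ∫ y in (0 : ℝ)..x, g y := by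
      simp only [primitive, ht]
      rw [intervalIntegral.integral_const_mul]
      ring
    rw [hζg, dir₂, this]
  have hF' : IsFrame (dir₁ t) (dir₂ t) γ₁ γ₂ := by
    rw [← e1, ← e2]
    exact hF
  refine ⟨t, R, hR, h.trans ?_⟩
  have g1 : γ₁ = curve₁ t :=
    eq_quatExp (continuous_ij_dir₁ t) (fun _ => ij_re _) hF'.zero₁ hF'.hasDerivAt₁
  -- Conjugation turns γ₂' = γ₂ζ₂ into an equation with the coefficient on the left, to which
  -- uniqueness applies.
  have g2 : (fun y => star (γ₂ y)) = quatExp fun y => -ij (dir₂ t y) := by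
    refine eq_quatExp (continuous_neg_ij_dir₂ t) (fun _ => neg_ij_re _) ?_ fun x => ?_
    · rw [hF'.zero₂, star_one]
    · refine (hF'.hasDerivAt₂ x).quaternion_star.congr_deriv ?_
      rw [star_mul, star_ij]
  have g2' : γ₂ = curve₂ t := by
    funext y
    rw [curve₂, ← g2, star_star]
  rw [coe_ofTarget, ← g1, ← g2']

/-! ### The invariants of an immersion -/

/-- The angular speed in the direction `v` of half the argument of the angle invariant. -/
def angularSpeed (φ : ℝ × ℝ → ℍ × ℍ) (v p : ℝ × ℝ) : ℝ :=
  (1 / 2) * (fderiv ℝ (angleInvariant φ) p v * star (angleInvariant φ p)).im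

/-- The constant `z` lets the same computation serve for normal forms, where z = e^{iθ₀}, and for
angle functions, where z = 1. -/
theorem angularSpeed_eq {φ : ℝ × ℝ → ℍ × ℍ} {θ : ℝ × ℝ → ℝ} {z : ℂ} (hz : ‖z‖ = 1)
    (h : ∀ p, angleInvariant φ p = z * Complex.exp ((2 * θ p : ℝ) * Complex.I))
    {p : ℝ × ℝ} {θ' : ℝ × ℝ →L[ℝ] ℝ} (hθ : HasFDerivAt θ θ' p) (v : ℝ × ℝ) :
    angularSpeed φ v p = θ' v := by
  have hc : HasFDerivAt (fun p => ((2 * θ p : ℝ) : ℂ) * Complex.I) _ p :=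
    (Complex.ofRealCLM.hasFDerivAt.comp p (hθ.const_mul 2)).mul_const Complex.I
  have hc := hc.cexp.const_mul z
  rw [angularSpeed, show angleInvariant φ = _ from funext h, hc.fderiv]
  have hn : ‖z * Complex.exp ((2 * θ p : ℝ) * Complex.I)‖ = 1 := by
    rw [norm_mul, hz, Complex.norm_exp_ofReal_mul_I, one_mul]
  set c := z * Complex.exp ((2 * θ p : ℝ) * Complex.I) with hcdef
  have hcc : c * star c = 1 := by
    have := Complex.mul_conj c
    rw [Complex.normSq_eq_norm_sq, hn] at this
    simpa using this
  have : z * (Complex.exp ((2 * θ p : ℝ) * Complex.I) * (((2 * θ' v : ℝ) : ℂ) * Complex.I)) *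
      star c = (2 * θ' v : ℝ) * Complex.I := by
    calc _ = c * star c * ((2 * θ' v : ℝ) * Complex.I) := by rw [hcdef]; ring
      _ = _ := by rw [hcc, one_mul]
  have e : (z • Complex.exp ((2 * θ p : ℝ) * Complex.I) • (Complex.I •
      Complex.ofRealCLM ∘L ((2 : ℝ) • θ')) : ℝ × ℝ →L[ℝ] ℂ) v * star c =
        (2 * θ' v : ℝ) * Complex.I := by
    rw [← this]
    simp
    left
    left
    ring
  refine Eq.trans (congrArg (fun w : ℂ => 1 / 2 * w.im) ?_) (show 1 / 2 *
    (((2 * θ' v : ℝ) : ℂ) * Complex.I).im = θ' v by simp)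
  exact e

theorem angleInvariant_ofTarget (t : Target) (p : ℝ × ℝ) :
    angleInvariant (ofTarget t).1 p = t.1 *
      Complex.exp ((2 * (primitive t.2.1 p.1 + primitive t.2.2 p.2) : ℝ) * Complex.I) := by
  have hs : star (dir₁ t p.1) = Complex.exp ((2 * primitive t.2.1 p.1 : ℝ) * Complex.I) := by
    rw [dir₁, Complex.star_def, ← Complex.exp_conj, map_mul, Complex.conj_ofReal, Complex.conj_I,
      Complex.ofReal_neg, neg_mul_neg]
  rw [coe_ofTarget, (isFrame_curve t).angleInvariant, hs, dir₂, mul_assoc, ← Complex.exp_add]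
  congr 2
  push_cast
  ring

theorem hasFDerivAt_primitive_add (f g : SmoothMap ℝ ℝ) (p : ℝ × ℝ) :
    HasFDerivAt (fun p : ℝ × ℝ => primitive f p.1 + primitive g p.2)
      ((ContinuousLinearMap.fst ℝ ℝ ℝ).smulRight (f p.1) +
        (ContinuousLinearMap.snd ℝ ℝ ℝ).smulRight (g p.2)) p :=
  (hasFDerivAt_comp_fst (hasDerivAt_primitive f p.1)).add
    (hasFDerivAt_comp_snd (hasDerivAt_primitive g p.2))

section

variable {φ : BHat} {t : Target} {R : ℍ ≃ₗᵢ[ℝ] ℍ} (h : postcomp R φ.1 = (ofTarget t).1)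
include h

theorem angleInvariant_eq_of_postcomp (p : ℝ × ℝ) :
    angleInvariant φ.1 p = t.1 *
      Complex.exp ((2 * (primitive t.2.1 p.1 + primitive t.2.2 p.2) : ℝ) * Complex.I) := by
  rw [← angleInvariant_ofTarget, ← h, angleInvariant_postcomp R φ.2.1.differentiable]

theorem angularSpeed_d1_of_postcomp (p : ℝ × ℝ) : angularSpeed φ.1 d1 p = t.2.1 p.1 := by
  rw [angularSpeed_eq (Circle.norm_coe t.1) (angleInvariant_eq_of_postcomp h)
    (hasFDerivAt_primitive_add _ _ p)]
  simp [d1]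

theorem angularSpeed_d2_of_postcomp (p : ℝ × ℝ) : angularSpeed φ.1 d2 p = t.2.2 p.2 := by
  rw [angularSpeed_eq (Circle.norm_coe t.1) (angleInvariant_eq_of_postcomp h)
    (hasFDerivAt_primitive_add _ _ p)]
  simp [d2]

end

theorem norm_angleInvariant (φ : BHat) (p : ℝ × ℝ) : ‖angleInvariant φ.1 p‖ = 1 := by
  obtain ⟨t, R, -, h⟩ := exists_postcomp_eq_ofTarget φ
  rw [angleInvariant_eq_of_postcomp h, norm_mul, Circle.norm_coe, Complex.norm_exp_ofReal_mul_I,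
    one_mul]

theorem smoothFam_fderiv_apply (v : ℝ × ℝ) :
    SmoothFam (fun (φ : BHat) p => fderiv ℝ φ.1 p v) :=
  (smoothFam_coe.comp_param (continuous_subtype_val (X := SmoothMap (ℝ × ℝ) (ℍ × ℍ)))).fderiv.clm_comp
    (ContinuousLinearMap.apply ℝ (ℍ × ℍ) v)

theorem SmoothFam.inner {T : Type*} [TopologicalSpace T] {E F : Type} [NormedAddCommGroup E]
    [NormedSpace ℝ E] [NormedAddCommGroup F] [InnerProductSpace ℝ F] {f g : T → E → F}
    (hf : SmoothFam f) (hg : SmoothFam g) : SmoothFam (fun t x => inner ℝ (f t x) (g t x)) :=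
  hf.bilinear (isBoundedBilinearMap_inner (𝕜 := ℝ) (E := F)).toContinuousLinearMap hg

theorem smoothFam_angleInvariant : SmoothFam (fun φ : BHat => angleInvariant φ.1) := by
  have hX := fun v => (smoothFam_fderiv_apply v).clm_comp (ContinuousLinearMap.fst ℝ ℍ ℍ)
  have hY := fun v => (smoothFam_fderiv_apply v).clm_comp (ContinuousLinearMap.snd ℝ ℍ ℍ)
  exact (((hX d1).inner (hX d2)).clm_comp Complex.ofRealCLM).add
    ((((hY d1).inner (hX d2)).clm_comp Complex.ofRealCLM).mul
      (smoothFam_const_left contDiff_const))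

theorem smoothFam_angularSpeed (v : ℝ × ℝ) :
    SmoothFam (fun φ : BHat => angularSpeed φ.1 v) := by
  have h1 := smoothFam_angleInvariant.fderiv.clm_comp (ContinuousLinearMap.apply ℝ ℂ v)
  have h2 := smoothFam_angleInvariant.clm_comp (Complex.conjCLE : ℂ →L[ℝ] ℂ)
  exact (smoothFam_const_left contDiff_const).mul ((h1.mul h2).clm_comp Complex.imCLM)

theorem smoothFam_angularSpeed₁ : SmoothFam (fun (φ : BHat) x => angularSpeed φ.1 d1 (x, 0)) :=
  (smoothFam_angularSpeed d1).comp_right (h := fun x : ℝ => (x, (0 : ℝ)))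
    (contDiff_id.prodMk contDiff_const)

theorem smoothFam_angularSpeed₂ : SmoothFam (fun (φ : BHat) y => angularSpeed φ.1 d2 (0, y)) :=
  (smoothFam_angularSpeed d2).comp_right (h := fun y : ℝ => ((0 : ℝ), y))
    (contDiff_const.prodMk contDiff_id)

/-- The map `Θ`. -/
def thetaMap (φ : BHat) : Target :=
  (⟨angleInvariant φ.1 0, mem_sphere_zero_iff_norm.2 (norm_angleInvariant φ 0)⟩,
    ⟨fun x => angularSpeed φ.1 d1 (x, 0), smoothFam_angularSpeed₁.contDiff φ⟩,
    ⟨fun y => angularSpeed φ.1 d2 (0, y), smoothFam_angularSpeed₂.contDiff φ⟩)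

theorem continuous_thetaMap : Continuous thetaMap := by
  refine Continuous.prodMk ?_ (Continuous.prodMk ?_ ?_)
  · exact Continuous.subtype_mk (smoothFam_angleInvariant.continuous.comp
      (Continuous.prodMk_left (0 : ℝ × ℝ))) _
  · exact continuous_smoothMap_iff.2 smoothFam_angularSpeed₁
  · exact continuous_smoothMap_iff.2 smoothFam_angularSpeed₂

/-- The angle invariant does not see `R`, and that of the normal form determines `t`. Invariance on
orbits and the fact that Θ is inverse to `ofTarget` both follow from this. -/
theorem thetaMap_eq_of_postcomp {φ : BHat} {t : Target} {R : ℍ ≃ₗᵢ[ℝ] ℍ}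
    (h : postcomp R φ.1 = (ofTarget t).1) : thetaMap φ = t := by
  refine Prod.ext (Circle.ext ?_) (Prod.ext (SmoothMap.ext fun x => ?_) (SmoothMap.ext fun y => ?_))
  · refine (angleInvariant_eq_of_postcomp h 0).trans ?_
    simp
  · exact angularSpeed_d1_of_postcomp h (x, 0)
  · exact angularSpeed_d2_of_postcomp h (0, y)

theorem thetaMap_ofTarget (t : Target) : thetaMap (ofTarget t) = t :=
  thetaMap_eq_of_postcomp (R := 1) rfl

theorem exists_postcomp_eq_ofTarget_thetaMap (φ : BHat) :
    ∃ R ∈ SOH, postcomp R φ.1 = (ofTarget (thetaMap φ)).1 := by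
  obtain ⟨t, R, hR, h⟩ := exists_postcomp_eq_ofTarget φ
  rw [thetaMap_eq_of_postcomp h]
  exact ⟨R, hR, h⟩

theorem mk_ofTarget_thetaMap (φ : BHat) :
    Quotient.mk orbitSetoid (ofTarget (thetaMap φ)) = Quotient.mk orbitSetoid φ := by
  obtain ⟨R, hR, h⟩ := exists_postcomp_eq_ofTarget_thetaMap φ
  exact (Quotient.sound (s := orbitSetoid)
    (show orbitSetoid.r φ (ofTarget (thetaMap φ)) from ⟨R, hR, h.symm⟩)).symm

theorem thetaMap_eq_of_rel {φ ψ : BHat} (h : orbitSetoid.r φ ψ) : thetaMap φ = thetaMap ψ := by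
  obtain ⟨R, hR, h⟩ := h
  obtain ⟨S, hS, h'⟩ := exists_postcomp_eq_ofTarget_thetaMap ψ
  refine thetaMap_eq_of_postcomp (R := S * R) ?_
  rw [← h', h]
  rfl

/-- The homeomorphism induced by `Θ`. -/
def thetaHomeomorph : BQuot ≃ₜ Target where
  toFun := Quotient.lift thetaMap fun _ _ => thetaMap_eq_of_rel
  invFun t := Quotient.mk orbitSetoid (ofTarget t)
  left_inv q := by
    induction q using Quotient.inductionOn with
    | h φ => exact mk_ofTarget_thetaMap φ
  right_inv := thetaMap_ofTarget
  continuous_toFun := continuous_thetaMap.quotient_lift _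
  continuous_invFun := continuous_quotient_mk'.comp continuous_ofTarget

/-! ### Angle functions -/

theorem orthonormal_frame {w : ℂ} (hw : ‖w‖ = 1) :
    Orthonormal ℝ ![1, ij w, ij (Complex.I * w), qk] := by
  have hI : ‖Complex.I * w‖ = 1 := by rw [norm_mul, Complex.norm_I, hw, one_mul]
  refine ⟨fun i => ?_, fun i j hne => ?_⟩
  · fin_cases i <;> simp [norm_ij, hw, norm_qk]
  · fin_cases i <;> fin_cases j <;> first
      | exact absurd rfl hne
      | (simp only [Fin.isValue, Fin.mk_one, Fin.zero_eta, Fin.reduceFinMk, Matrix.cons_val,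
          inner_quaternion]
         simp
         try ring)

theorem re_sq_add_im_sq {w : ℂ} (hw : ‖w‖ = 1) : w.re * w.re + w.im * w.im = 1 := by
  rw [← Complex.normSq_apply, Complex.normSq_eq_norm_sq, hw]
  norm_num

/-- Here s is the half sum and θ the half difference of the arguments of ζ₁ and ζ₂. Then ζ₁ + ζ₂ = 2
cos θ e^{is} and ζ₁ - ζ₂ = -2i sin θ e^{is}, so e₁ and e₂ are the images of e^{is} and ie^{is} under
q ↦ γ₂qγ₁. -/
theorem IsFrame.isAngleFunction {ζ₁ ζ₂ : ℝ → ℂ} {γ₁ γ₂ : ℝ → ℍ} (h : IsFrame ζ₁ ζ₂ γ₁ γ₂)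
    {θ s : ℝ × ℝ → ℝ} (hθ : ContDiff ℝ ∞ θ) (hs : ContDiff ℝ ∞ s)
    (h₁ : ∀ p, ζ₁ p.1 = Complex.exp ((s p - θ p : ℝ) * Complex.I))
    (h₂ : ∀ p, ζ₂ p.2 = Complex.exp ((s p + θ p : ℝ) * Complex.I)) :
    IsAngleFunction (prodMap γ₁ γ₂) θ := by
  set w : ℝ × ℝ → ℂ := fun p => Complex.exp ((s p : ℝ) * Complex.I) with hwdef
  have hw : ∀ p, ‖w p‖ = 1 := fun p => Complex.norm_exp_ofReal_mul_I _
  have hws : ContDiff ℝ ∞ w := ((Complex.ofRealCLM.contDiff.comp hs).mul contDiff_const).cexp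
  have h1 := h.smooth₁.comp (contDiff_fst (E := ℝ) (F := ℝ))
  have h2 := h.smooth₂.comp (contDiff_snd (E := ℝ) (F := ℝ))
  have hsum : ∀ p, ζ₁ p.1 + ζ₂ p.2 = (2 * cos (θ p) : ℝ) * w p := fun p => by
    rw [h₁, h₂, hwdef]
    push_cast
    rw [sub_mul, add_mul, Complex.exp_sub, Complex.exp_add, Complex.two_cos, div_eq_mul_inv,
      ← Complex.exp_neg, neg_mul]
    ring
  have hdiff : ∀ p, ζ₁ p.1 - ζ₂ p.2 = -(2 * sin (θ p) : ℝ) * (Complex.I * w p) := fun p => by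
    rw [h₁, h₂, hwdef]
    push_cast
    rw [sub_mul, add_mul, Complex.exp_sub, Complex.exp_add, Complex.two_sin, div_eq_mul_inv,
      ← Complex.exp_neg]
    simp only [neg_mul]
    linear_combination (Complex.exp (s p * Complex.I) * (Complex.exp (-(θ p * Complex.I))
      - Complex.exp (θ p * Complex.I))) * Complex.I_mul_I
  refine ⟨hθ, fun p => γ₂ p.2 * ij (w p) * γ₁ p.1, fun p => γ₂ p.2 * ij (Complex.I * w p) * γ₁ p.1,
    (h2.mul (ij.contDiff.comp hws)).mul h1,
    (h2.mul (ij.contDiff.comp (contDiff_const.mul hws))).mul h1, fun p => ⟨?_, ?_, ?_, ?_⟩⟩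
  · have := (orthonormal_frame (hw p)).comp_linearIsometry
      (sandwich (γ₂ p.2) (γ₁ p.1) (h.norm₂ _) (h.norm₁ _)).toLinearIsometry
    convert this using 1
    funext i
    fin_cases i
    · simp [prodMap]
    · rfl
    · rfl
    · rfl
  · rw [h.vol_prodMap]
    have := re_sq_add_im_sq (hw p)
    simp
    linarith
  · rw [h.fderiv_prodMap]
    have e1 : ((1 / 2 : ℝ) • (d1 + d2)).1 = 1 / 2 := by simp [d1, d2]
    have e2 : ((1 / 2 : ℝ) • (d1 + d2)).2 = 1 / 2 := by simp [d1, d2]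
    rw [e1, e2, ← smul_add, ← smul_sub, hsum, hdiff]
    have f1 : (1 / 2 : ℝ) • (((2 * cos (θ p) : ℝ) : ℂ) * w p) = cos (θ p) • w p := by
      rw [Complex.real_smul, Complex.real_smul]; push_cast; ring
    have f2 : Complex.I * ((1 / 2 : ℝ) • (-((2 * sin (θ p) : ℝ) : ℂ) * (Complex.I * w p))) =
        sin (θ p) • w p := by
      rw [Complex.real_smul, Complex.real_smul]; push_cast
      linear_combination (-(Complex.sin (θ p)) * w p) * Complex.I_mul_I
    rw [f1, f2]
    simp only [map_smul, mul_smul_comm, smul_mul_assoc]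
  · rw [h.fderiv_prodMap]
    have e1 : ((1 / 2 : ℝ) • (d1 - d2)).1 = 1 / 2 := by simp [d1, d2]
    have e2 : ((1 / 2 : ℝ) • (d1 - d2)).2 = -(1 / 2) := by simp [d1, d2]
    rw [e1, e2, neg_smul, ← sub_eq_add_neg, sub_neg_eq_add, ← smul_add, ← smul_sub, hsum, hdiff]
    have f1 : (1 / 2 : ℝ) • (-((2 * sin (θ p) : ℝ) : ℂ) * (Complex.I * w p)) =
        -sin (θ p) • (Complex.I * w p) := by
      rw [Complex.real_smul, Complex.real_smul]; push_cast; ring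
    have f2 : Complex.I * ((1 / 2 : ℝ) • (((2 * cos (θ p) : ℝ) : ℂ) * w p)) =
        cos (θ p) • (Complex.I * w p) := by
      rw [Complex.real_smul, Complex.real_smul]; push_cast; ring
    rw [f1, f2]
    simp only [map_smul, mul_smul_comm, smul_mul_assoc]

theorem isAngleFunction_ofTarget (t : Target) :
    ∃ θ, IsAngleFunction (ofTarget t).1 θ := by
  set a : ℝ := Complex.arg t.1
  have ha : (t.1 : ℂ) = Complex.exp (a * Complex.I) := by
    have := Complex.norm_mul_exp_arg_mul_I (t.1 : ℂ)
    rw [Circle.norm_coe] at this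
    simpa using this.symm
  have hF : ContDiff ℝ ∞ (fun p : ℝ × ℝ => primitive t.2.1 p.1) :=
    (contDiff_primitive _).comp contDiff_fst
  have hG : ContDiff ℝ ∞ (fun p : ℝ × ℝ => primitive t.2.2 p.2) :=
    (contDiff_primitive _).comp contDiff_snd
  refine ⟨_, (isFrame_curve t).isAngleFunction
    -- Half difference and half sum of the arguments -2F₁ of ζ₁ and a + 2F₂ of ζ₂.
    (θ := fun p => a / 2 + primitive t.2.1 p.1 + primitive t.2.2 p.2)
    (s := fun p => a / 2 - primitive t.2.1 p.1 + primitive t.2.2 p.2)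
    ((contDiff_const.add hF).add hG) ((contDiff_const.sub hF).add hG) (fun p => ?_) fun p => ?_⟩
  · rw [dir₁]
    congr 3
    ring
  · rw [dir₂, ha, ← Complex.exp_add, ← add_mul, ← Complex.ofReal_add]
    congr 3
    ring

/-! ### Initial angles -/

/-- The invariant at the origin involves only γ₁'(0) and γ₂'(0), so e^{iθ₀} does not depend on the
rotation or the factorization. -/
theorem IsInitialAngle.angleInvariant {φ : ℝ × ℝ → ℍ × ℍ} {θ₀ : ℝ} (h : IsInitialAngle φ θ₀)
    (hφ : Differentiable ℝ φ) : angleInvariant φ 0 = Complex.exp (θ₀ * Complex.I) := by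
  obtain ⟨-, R, -, γ₁, γ₂, hf, h₁, h₂⟩ := h
  rw [← angleInvariant_postcomp R hφ]
  have he : postcomp R φ = prodMap γ₁ γ₂ := by
    funext p
    rw [hf.eq p, mul_one]
    rfl
  have d₁ : HasDerivAt γ₁ (ij 1) 0 := by
    have := (hf.smooth₁.differentiable (by simp) 0).hasDerivAt
    rw [h₁] at this
    rw [show ij 1 = qi by simp [ij_apply]]
    exact this
  have d₂ : HasDerivAt γ₂ (ij (Complex.exp (θ₀ * Complex.I))) 0 := by
    have := (hf.smooth₂.differentiable (by simp) 0).hasDerivAt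
    rw [h₂, exp_smul_qk_mul_qi] at this
    exact this
  have hd := fderiv_prodMap_apply (p := (0 : ℝ × ℝ)) d₁ d₂
  rw [he, Bilegendrian.angleInvariant, hd, hd]
  simp only [d1, d2, Prod.fst_zero, Prod.snd_zero, hf.zero₁, hf.zero₂, one_smul, zero_smul,
    add_zero, zero_add, one_mul, mul_one, qk_mul_ij, inner_ij]
  apply Complex.ext <;> simp [Complex.cos_ofReal_re, Complex.sin_ofReal_re]

theorem exists_mem_Ico_circle_exp (z : Circle) : ∃ θ₀ ∈ Ico 0 (2 * π), Circle.exp θ₀ = z := by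
  refine ⟨toIcoMod Real.two_pi_pos 0 (Complex.arg z), ?_, ?_⟩
  · simpa using toIcoMod_mem_Ico Real.two_pi_pos 0 (Complex.arg z)
  · rw [toIcoMod, Circle.periodic_exp.sub_zsmul_eq, Circle.exp_arg]

theorem exists_isInitialAngle (φ : BHat) :
    ∃ θ₀, IsInitialAngle φ.1 θ₀ ∧ (thetaMap φ).1 = Circle.exp θ₀ := by
  obtain ⟨R, hR, h⟩ := exists_postcomp_eq_ofTarget_thetaMap φ
  obtain ⟨θ₀, hθ₀, hz⟩ := exists_mem_Ico_circle_exp (thetaMap φ).1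
  have hF := isFrame_curve (thetaMap φ)
  refine ⟨θ₀, ⟨hθ₀, R, hR, curve₁ (thetaMap φ), curve₂ (thetaMap φ), ?_, ?_, ?_⟩, hz.symm⟩
  · rw [h]
    exact hF.isFactorization
  · rw [(hF.hasDerivAt₁ 0).deriv, hF.zero₁]
    simp [dir₁, ij_apply]
  · rw [(hF.hasDerivAt₂ 0).deriv, hF.zero₂, exp_smul_qk_mul_qi, one_mul, dir₂, ← hz]
    simp [Circle.coe_exp]

theorem IsInitialAngle.thetaMap_fst {φ : BHat} {θ₀ : ℝ} (h : IsInitialAngle φ.1 θ₀) :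
    (thetaMap φ).1 = Circle.exp θ₀ :=
  Circle.ext ((h.angleInvariant φ.2.1.differentiable).trans (Circle.coe_exp θ₀).symm)

theorem postcomp_inv_postcomp (R : ℍ ≃ₗᵢ[ℝ] ℍ) (φ : ℝ × ℝ → ℍ × ℍ) :
    postcomp R⁻¹ (postcomp R φ) = φ :=
  funext fun _ => Prod.ext (R.symm_apply_apply _) (R.symm_apply_apply _)

theorem IsAngleFunction.fderiv_eq {φ : ℝ × ℝ → ℍ × ℍ} {θ : ℝ × ℝ → ℝ} (h : IsAngleFunction φ θ)
    (p v : ℝ × ℝ) : fderiv ℝ θ p v = angularSpeed φ v p :=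
  (angularSpeed_eq (z := 1) norm_one (fun p => by rw [h.angleInvariant, one_mul])
    (h.1.differentiable (by simp) p).hasFDerivAt v).symm

theorem isTheta_iff (φ : BHat) (t : Target) : IsTheta φ.1 t ↔ thetaMap φ = t := by
  obtain ⟨R, hR, h⟩ := exists_postcomp_eq_ofTarget_thetaMap φ
  constructor
  · rintro ⟨⟨θ₀, hθ₀, h1⟩, ⟨θ, hθ⟩, h2⟩
    have h3 := h2 θ hθ
    refine Prod.ext (hθ₀.thetaMap_fst.trans h1.symm)
      (Prod.ext (SmoothMap.ext fun x => ?_) (SmoothMap.ext fun y => ?_))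
    · rw [← (h3 (x, 0)).1, hθ.fderiv_eq]
      rfl
    · rw [← (h3 (0, y)).2, hθ.fderiv_eq]
      rfl
  · rintro rfl
    refine ⟨exists_isInitialAngle φ, ?_, fun θ hθ p => ?_⟩
    · obtain ⟨θ, hθ⟩ := isAngleFunction_ofTarget (thetaMap φ)
      refine ⟨θ, ?_⟩
      rw [← postcomp_inv_postcomp R φ.1, h]
      exact hθ.postcomp (ofTarget (thetaMap φ)).2.1.differentiable (SOH.inv_mem hR)
    · rw [hθ.fderiv_eq, hθ.fderiv_eq]
      exact ⟨angularSpeed_d1_of_postcomp h p, angularSpeed_d2_of_postcomp h p⟩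

/-! ### Flat surfaces -/

section

variable {φ : BHat} {ζ₁ ζ₂ : ℝ → ℂ} {γ₁ γ₂ : ℝ → ℍ} {R : ℍ ≃ₗᵢ[ℝ] ℍ}
  (hF : IsFrame ζ₁ ζ₂ γ₁ γ₂) (h : postcomp R φ.1 = prodMap γ₁ γ₂)
include hF h

theorem apply_fderiv_fst (p v : ℝ × ℝ) :
    R (fderiv ℝ (fun p => (φ.1 p).1) p v) =
      γ₂ p.2 * ij (v.1 • ζ₁ p.1 + v.2 • ζ₂ p.2) * γ₁ p.1 := by
  have h1 := fderiv_postcomp R (φ.2.1.differentiable p) v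
  rw [h, hF.fderiv_prodMap] at h1
  rw [(φ.2.1.differentiable p).hasFDerivAt.fst.fderiv]
  exact (congrArg Prod.fst h1).symm

theorem inner_fderiv_fst (p v w : ℝ × ℝ) :
    inner ℝ (fderiv ℝ (fun p => (φ.1 p).1) p v) (fderiv ℝ (fun p => (φ.1 p).1) p w) =
      inner ℝ (v.1 • ζ₁ p.1 + v.2 • ζ₂ p.2) (w.1 • ζ₁ p.1 + w.2 • ζ₂ p.2) := by
  rw [← R.inner_map_map, apply_fderiv_fst hF h, apply_fderiv_fst hF h, hF.inner_sandwich,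
    inner_ij, Complex.inner]
  simp
  ring

/-- The kernel consists of the real linear relations between ζ₁ and ζ₂. Writing ζ₂ = cζ₁, these are
trivial unless c is real, in which case (c, -1) is one. -/
theorem injective_fderiv_fst_iff (p : ℝ × ℝ) :
    Function.Injective (fderiv ℝ (fun p => (φ.1 p).1) p) ↔
      (ζ₂ p.2 * star (ζ₁ p.1)).im ≠ 0 := by
  have hu : ζ₁ p.1 * star (ζ₁ p.1) = 1 := by
    have := Complex.mul_conj (ζ₁ p.1)
    rw [Complex.normSq_eq_norm_sq, hF.norm_dir₁] at this
    simpa using this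
  have hker : ∀ v : ℝ × ℝ, fderiv ℝ (fun p => (φ.1 p).1) p v = 0 ↔
      v.1 • ζ₁ p.1 + v.2 • ζ₂ p.2 = 0 := fun v => by
    rw [← inner_self_eq_zero (𝕜 := ℝ), inner_fderiv_fst hF h, inner_self_eq_zero]
  rw [injective_iff_map_eq_zero]
  set c := ζ₂ p.2 * star (ζ₁ p.1) with hc
  have hζ : ζ₂ p.2 = c * ζ₁ p.1 := by
    rw [hc]
    linear_combination (-ζ₂ p.2) * hu
  constructor
  · intro hinj him
    have := hinj (c.re, -1) ((hker _).2 ?_)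
    · simpa using congrArg Prod.snd this
    · have hcre : c = (c.re : ℂ) := Complex.ext rfl (by simpa using him)
      rw [hζ, hcre]
      simp
  · intro him v hv
    have h0 := (hker v).1 hv
    have h1 : (v.1 : ℂ) + v.2 * c = 0 := by
      have h2 : (v.1 • ζ₁ p.1 + v.2 • ζ₂ p.2) * star (ζ₁ p.1) = 0 := by rw [h0, zero_mul]
      rw [Complex.real_smul, Complex.real_smul, hζ] at h2
      linear_combination h2 - ((v.1 : ℂ) + v.2 * c) * hu
    have him' := congrArg Complex.im h1
    have hre' := congrArg Complex.re h1
    simp at him' hre'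
    have hv2 : v.2 = 0 := him'.resolve_right him
    have hv1 : v.1 = 0 := by simpa [hv2] using hre'
    exact Prod.ext hv1 hv2

/-- A global chart is (x₁, x₂) ↦ ∫ζ₁ + ∫ζ₂ in ℂ: its differential v₁ζ₁ + v₂ζ₂ has the same inner
products as that of X. -/
theorem inducedMetricIsFlat (h₁ : ContDiff ℝ ∞ ζ₁) (h₂ : ContDiff ℝ ∞ ζ₂) :
    InducedMetricIsFlat fun p => (φ.1 p).1 := by
  have hP : ∀ ζ : ℝ → ℂ, ContDiff ℝ ∞ ζ →
      ∀ x, HasDerivAt (fun x => ∫ y in (0 : ℝ)..x, ζ y) (ζ x) x := fun ζ hζ x =>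
    intervalIntegral.integral_hasDerivAt_right (hζ.continuous.intervalIntegrable _ _)
      (hζ.continuous.stronglyMeasurableAtFilter _ _) hζ.continuous.continuousAt
  have hPs : ∀ ζ : ℝ → ℂ, ContDiff ℝ ∞ ζ → ContDiff ℝ ∞ (fun x => ∫ y in (0 : ℝ)..x, ζ y) :=
    fun ζ hζ => contDiff_infty_iff_deriv.2 ⟨fun x => (hP ζ hζ x).differentiableAt, by
      rw [show deriv (fun x => ∫ y in (0 : ℝ)..x, ζ y) = ζ from funext fun x => (hP ζ hζ x).deriv]
      exact hζ⟩
  set e := Complex.orthonormalBasisOneI.repr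
  set f : ℝ × ℝ → ℂ := fun p => (∫ y in (0 : ℝ)..p.1, ζ₁ y) + ∫ y in (0 : ℝ)..p.2, ζ₂ y
  have hfs : ContDiff ℝ ∞ f :=
    ((hPs _ h₁).comp contDiff_fst).add ((hPs _ h₂).comp contDiff_snd)
  have hf : ∀ p v, fderiv ℝ (fun p => e (f p)) p v = e (v.1 • ζ₁ p.1 + v.2 • ζ₂ p.2) := by
    intro p v
    have := e.toContinuousLinearEquiv.hasFDerivAt.comp p
      ((hasFDerivAt_comp_fst (hP _ h₁ p.1)).add (hasFDerivAt_comp_snd (hP _ h₂ p.2)))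
    rw [show fderiv ℝ (fun p => e (f p)) p = _ from this.fderiv]
    rfl
  intro p
  refine ⟨univ, isOpen_univ, mem_univ _, fun p => e (f p),
    (e.toContinuousLinearEquiv.contDiff.comp hfs).contDiffOn, fun q _ v w => ?_⟩
  rw [hf, hf, e.inner_map_map, inner_fderiv_fst hF h]

theorem isFlatImmersion_iff (h₁ : ContDiff ℝ ∞ ζ₁) (h₂ : ContDiff ℝ ∞ ζ₂) :
    IsFlatImmersion (fun p => (φ.1 p).1) ↔
      ∀ p : ℝ × ℝ, (ζ₂ p.2 * star (ζ₁ p.1)).im ≠ 0 := by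
  constructor
  · intro hX p
    exact (injective_fderiv_fst_iff hF h p).1 (hX.immersion p)
  · intro hc
    exact ⟨φ.1.smooth.fst, φ.2.1.norm_fst, fun p => (injective_fderiv_fst_iff hF h p).2 (hc p),
      inducedMetricIsFlat hF h h₁ h₂⟩

end

theorem isFlatImmersion_iff_primitiveImage (φ : BHat) {θ₀ : ℝ} (hθ₀ : IsInitialAngle φ.1 θ₀) :
    IsFlatImmersion (fun p => (φ.1 p).1) ↔
      ({θ₀ / 2} + primitiveImage (thetaMap φ).2.1 + primitiveImage (thetaMap φ).2.2)
        ∩ range (fun n : ℤ => (n : ℝ) * (π / 2)) = ∅ := by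
  obtain ⟨R, hR, h⟩ := exists_postcomp_eq_ofTarget_thetaMap φ
  have ht := hθ₀.thetaMap_fst
  set t := thetaMap φ
  rw [isFlatImmersion_iff (isFrame_curve t) h (smoothFam_dir₁.contDiff t)
    (smoothFam_dir₂.contDiff t)]
  -- The quantity to keep nonzero is sin 2θ with θ = θ₀/2 + F₁ + F₂; it vanishes exactly when θ is a
  -- multiple of π/2.
  have him : ∀ p : ℝ × ℝ, (dir₂ t p.2 * star (dir₁ t p.1)).im =
      sin (2 * (θ₀ / 2 + primitive t.2.1 p.1 + primitive t.2.2 p.2)) := by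
    intro p
    rw [← (isFrame_curve t).angleInvariant, ← coe_ofTarget, angleInvariant_ofTarget, ht,
      Circle.coe_exp, ← Complex.exp_add, ← add_mul, ← Complex.ofReal_add,
      Complex.exp_ofReal_mul_I_im]
    congr 1
    ring
  rw [eq_empty_iff_forall_notMem]
  constructor
  · rintro hc a ⟨ha, n, hn⟩
    obtain ⟨b, hb, _, ⟨y, rfl⟩, rfl⟩ := ha
    obtain ⟨_, rfl, _, ⟨x, rfl⟩, rfl⟩ := hb
    refine hc (x, y) ?_
    rw [him, Real.sin_eq_zero_iff]
    refine ⟨n, ?_⟩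
    simp only at hn
    simp only [primitive]
    linarith
  · intro hc p hp
    rw [him, Real.sin_eq_zero_iff] at hp
    obtain ⟨n, hn⟩ := hp
    refine hc (θ₀ / 2 + primitive t.2.1 p.1 + primitive t.2.2 p.2)
      ⟨add_mem_add (add_mem_add rfl ⟨p.1, rfl⟩) ⟨p.2, rfl⟩, n, ?_⟩
    simp only
    linarith

end Bilegendrian

end

open Bilegendrian
theorem mainTheorem4 :
    ∃ Θ : BHat → Target,
      (∀ (φ : BHat) (t : Target), IsTheta φ.1 t ↔ Θ φ = t) ∧
      (∃ h : BQuot ≃ₜ Target, ∀ φ : BHat, h (Quotient.mk orbitSetoid φ) = Θ φ) ∧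
      ∀ (φ : BHat) (θ₀ : ℝ), IsInitialAngle φ.1 θ₀ →
        (IsFlatImmersion (fun p => (φ.1 p).1) ↔
          ({θ₀ / 2} + primitiveImage (Θ φ).2.1 + primitiveImage (Θ φ).2.2)
            ∩ range (fun n : ℤ => (n : ℝ) * (π / 2)) = ∅) :=
  ⟨thetaMap, isTheta_iff, ⟨thetaHomeomorph, fun _ => rfl⟩,
    fun φ _ hθ₀ => isFlatImmersion_iff_primitiveImage φ hθ₀⟩
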